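/- NUMBER PARTITIONING is the following decision problem: given positive integers $t$ and $a_1,\dots,a_m$ ($m\ge 1$) such that $\sum_{i=1}^m a_i$ is divisible by $t$, decide whether there is a partition of $\{1,\dots,m\}$ into $t$ sets $I_1,\dots,I_t$ with $\sum_{i\in I_j}a_i=\frac1t\sum_{i=1}^m a_i$ for all $j=1,\dots,t$. For $p\in[0,1]^n$ let $\mu_p$ be the probability measure on $\{0,1\}^n\subseteq[0,1]^n$ with $\mu_p(\{x\})=\prod_{i:x_i=1}p_i\prod_{i:x_i=0}(1-p_i)$. A finite set $B\subseteq[0,1]^n$ is a Pareto cover of $\mu_p$ if $\mu_p(\{x : x\le b\text{ for some }b\in B\})=1$ (where $x\le b$ is meant coordinatewise). For $c\in\mathbb{Q}^n_{\ge0}$ put $c_B(x)=\min\{c^{\mathsf T}b : b\in B,\ x\le b\}$ (with $\min\emptyset=\infty$). The binary Pareto cover decision problem is: given $p\in([0,1]\cap\mathbb{Q})^n$, $c\in\mathbb{Q}^n_{\ge 0}$, $\gamma\in\mathbb{Q}$ and an integer $k\ge1$, decide whether there is a Pareto cover $B\subseteq[0,1]^n$ of $\mu_p$ with $|B|=k$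 and $\operatorname{E}_{\mu_p}[c_B]\le\gamma$. In both problems all numbers are encoded in binary, a rational number being given by a numerator and a positive denominator (not necessarily in lowest terms). Theorem. There is a polynomial-time (many-one) reduction from NUMBER PARTITIONING to the binary Pareto cover decision problem, i.e., a map computable by a Turing machine in time polynomial in the encoding length of the input that maps "yes" instances to "yes" instances and "no" instances to "no" instances, with the following property. It maps every instance $t,a_1,\dots,a_m$ to an instance with $n=m+1$ coordinates and cover size $k=t+2$, namely, with $S=\sum_{i=1}^m a_i$ and $M=13\,S^2$, to the one given by \[ p_i=\frac{a_i}{M^4},\quad c_i=a_i\quad(i=1,\dots,m),\qquad p_{m+1}=\frac1{M^6},\quad c_{m+1}=2M,\qquad \gamma=\frac1{M^4}\cdot\frac{S^2}{t}+\frac6{M^5}. \] -/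

import Mathlib

open MeasureTheory Computability
open scoped ENNReal

namespace ParetoCover

/-! ### Decision problems and polynomial-time many-one reductions -/

/-- A decision problem: its instances, an encoding of the instances by words over the finite
alphabet `Γ'` (which contains the two bits and a comma), and the set of "yes" instances. -/
structure DecisionProblem where
  Instance : Type
  encode : Instance → List Γ'
  encode_injective : Function.Injective encode
  IsYes : Instance → Prop

/-- `f` is a polynomial-time (many-one) reduction from `A` to `B`: a Turing machine computes `f` on
the encoded instances in a number of steps that is polynomial in the length of the encoded input,
and `f` maps "yes" instances to "yes" instances and "no" instances to "no" instances. -/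
def IsPolyTimeReduction (A B : DecisionProblem) (f : A.Instance → B.Instance) : Prop :=
  Nonempty (Turing.TM2ComputableInPolyTime A.encode B.encode f) ∧
    ∀ I : A.Instance, A.IsYes I ↔ B.IsYes (f I)

/-! ### Binary encodings -/

/-- The encoding of a finite list of natural numbers: every number is written in binary and is
followed by a comma. -/
def encodeNats (l : List ℕ) : List Γ' :=
  l.flatMap fun a => (encodeNat a).map Γ'.bit ++ [Γ'.comma]

theorem bits_append_comma_inj {u v : List Bool} {x y : List Γ'}
    (h : u.map Γ'.bit ++ Γ'.comma :: x = v.map Γ'.bit ++ Γ'.comma :: y) : u = v ∧ x = y := by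
  induction u generalizing v with
  | nil =>
    cases v with
    | nil => simpa using h
    | cons b v => simp at h
  | cons a u ih =>
    cases v with
    | nil => simp at h
    | cons b v =>
      simp only [List.map_cons, List.cons_append, List.cons.injEq, Γ'.bit.injEq] at h
      obtain ⟨h1, h2⟩ := ih h.2
      exact ⟨by rw [h.1, h1], h2⟩

theorem encodeNats_injective : Function.Injective encodeNats := by
  intro l
  induction l with
  | nil =>
    intro l' h
    cases l' with
    | nil => rfl
    | cons b l' => simp [encodeNats] at h
  | cons a l ih =>
    intro l' h
    cases l' with
    | nil => simp [encodeNats] at h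
    | cons b l' =>
      simp only [encodeNats, List.flatMap_cons, List.append_assoc, List.singleton_append] at h
      obtain ⟨h1, h2⟩ := bits_append_comma_inj h
      have h3 : a = b := by
        have := congrArg decodeNat h1
        simpa using this
      rw [h3, ih h2]

/-- A rational number given as a quotient of an integer and a positive integer
(not necessarily in lowest terms). -/
@[ext]
structure Fraction where
  num : ℤ
  den : ℕ
  den_pos : 0 < den

namespace Fraction

/-- The rational number that a fraction represents. -/
def val (q : Fraction) : ℚ := (q.num : ℚ) / (q.den : ℚ)

/-- Sign, absolute value of the numerator, and denominator. -/
def toNats (q : Fraction) : List ℕ := [if q.num < 0 then 1 else 0, q.num.natAbs, q.den]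

theorem toNats_append_inj {q r : Fraction} {x y : List ℕ}
    (h : q.toNats ++ x = r.toNats ++ y) : q = r ∧ x = y := by
  simp only [toNats, List.cons_append, List.nil_append, List.cons.injEq] at h
  obtain ⟨h1, h2, h3, h4⟩ := h
  refine ⟨Fraction.ext ?_ h3, h4⟩
  split_ifs at h1 <;> omega

end Fraction

/-! ### NUMBER PARTITIONING -/

/-- An instance of NUMBER PARTITIONING: positive integers `t` and `a₁, …, aₘ` such that
`a₁ + ⋯ + aₘ` is divisible by `t`. -/
@[ext]
structure NumberPartitioningInstance where
  m : ℕ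
  t : ℕ
  a : Fin m → ℕ
  m_pos : 0 < m
  t_pos : 0 < t
  a_pos : ∀ i, 0 < a i
  dvd_sum : t ∣ ∑ i, a i

namespace NumberPartitioningInstance

/-- The encoding `t, a₁, …, aₘ` (all numbers in binary). -/
def encode (I : NumberPartitioningInstance) : List Γ' :=
  encodeNats (I.t :: List.ofFn I.a)

theorem encode_injective : Function.Injective encode := by
  rintro ⟨m, t, a, _, _, _, _⟩ ⟨m', t', a', _, _, _, _⟩ h
  have h' := encodeNats_injective h
  simp only [List.cons.injEq] at h'
  obtain ⟨rfl, h2⟩ := h'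
  have hm : m = m' := by simpa using congrArg List.length h2
  subst hm
  obtain rfl := List.ofFn_injective h2
  rfl

/-- There is a partition of the index set into `t` sets `P 1, …, P t`, each of which has the sum
`(1 / t) * (a₁ + ⋯ + aₘ)`. -/
def IsYes (I : NumberPartitioningInstance) : Prop :=
  ∃ P : Fin I.t → Finset (Fin I.m),
    Pairwise (fun j l => Disjoint (P j) (P l)) ∧
    (∀ i, ∃ j, i ∈ P j) ∧
    ∀ j, ∑ i ∈ P j, (I.a i : ℚ) = 1 / (I.t : ℚ) * ∑ i, (I.a i : ℚ)

end NumberPartitioningInstance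

/-- The decision problem NUMBER PARTITIONING. -/
def numberPartitioning : DecisionProblem where
  Instance := NumberPartitioningInstance
  encode := NumberPartitioningInstance.encode
  encode_injective := NumberPartitioningInstance.encode_injective
  IsYes := NumberPartitioningInstance.IsYes

/-! ### Pareto covers -/

/-- The cube `[0,1]ⁿ`, with the coordinatewise order and the Borel σ-algebra. -/
abbrev Cube (n : ℕ) : Type := Fin n → unitInterval

/-- The point of `{0,1}ⁿ ⊆ [0,1]ⁿ` with the given coordinates. -/
def binaryPoint {n : ℕ} (x : Fin n → Bool) : Cube n := fun i => if x i then 1 else 0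

/-- The measure `μ_p`, which is carried by `{0,1}ⁿ` and gives a point `x ∈ {0,1}ⁿ` the mass
`∏_{i : xᵢ = 1} pᵢ * ∏_{i : xᵢ = 0} (1 - pᵢ)`. -/
noncomputable def bernoulliMeasure {n : ℕ} (p : Fin n → ℝ) : Measure (Cube n) :=
  ∑ x : Fin n → Bool,
    ENNReal.ofReal ((∏ i with x i = true, p i) * ∏ i with x i = false, (1 - p i)) •
      Measure.dirac (binaryPoint x)

/-- `B` is a Pareto cover of `μ`: almost every point is covered by a point of `B`. -/
def IsParetoCover {n : ℕ} (μ : Measure (Cube n)) (B : Finset (Cube n)) : Prop :=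
  μ {x | ∃ b ∈ B, x ≤ b} = 1

/-- `c_B x`, the smallest cost `cᵀ b` of a point `b ∈ B` that covers `x` (`∞` if there is none),
for a cost vector `c` with nonnegative entries. -/
noncomputable def coverCost {n : ℕ} (c : Fin n → ℝ) (B : Finset (Cube n)) (x : Cube n) : ℝ≥0∞ :=
  ⨅ b ∈ B, ⨅ _ : x ≤ b, ENNReal.ofReal (∑ i, c i * (b i : ℝ))

/-- The expected cost `E_μ[c_B]`, for a cost vector `c` with nonnegative entries. -/
noncomputable def expectedCost {n : ℕ} (μ : Measure (Cube n)) (c : Fin n → ℝ)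
    (B : Finset (Cube n)) : ℝ≥0∞ :=
  ∫⁻ x, coverCost c B x ∂μ

/-! ### The binary Pareto cover problem -/

/-- An instance of the binary Pareto cover problem: `p ∈ ([0,1] ∩ ℚ)ⁿ`, `c ∈ ℚⁿ` with nonnegative
entries, `γ ∈ ℚ` and an integer `k ≥ 1`. -/
@[ext]
structure BinaryParetoInstance where
  n : ℕ
  k : ℕ
  γ : Fraction
  p : Fin n → Fraction
  c : Fin n → Fraction
  k_pos : 0 < k
  p_mem : ∀ i, (p i).val ∈ Set.Icc (0 : ℚ) 1
  c_nonneg : ∀ i, 0 ≤ (c i).val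

namespace BinaryParetoInstance

/-- The encoding `k, γ, p₁, c₁, …, pₙ, cₙ` (all integers in binary). -/
def encode (J : BinaryParetoInstance) : List Γ' :=
  encodeNats (J.k :: (J.γ.toNats ++
    (List.ofFn fun i => (J.p i).toNats ++ (J.c i).toNats).flatten))

theorem flatten_inj {l l' : List (Fraction × Fraction)}
    (h : (l.map fun q => q.1.toNats ++ q.2.toNats).flatten =
      (l'.map fun q => q.1.toNats ++ q.2.toNats).flatten) : l = l' := by
  induction l generalizing l' with
  | nil =>
    cases l' with
    | nil => rfl
    | cons r l' => simp [Fraction.toNats] at h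
  | cons q l ih =>
    cases l' with
    | nil => simp [Fraction.toNats] at h
    | cons r l' =>
      simp only [List.map_cons, List.flatten_cons, List.append_assoc] at h
      obtain ⟨h1, h⟩ := Fraction.toNats_append_inj h
      obtain ⟨h2, h⟩ := Fraction.toNats_append_inj h
      rw [Prod.ext h1 h2, ih h]

theorem encode_injective : Function.Injective encode := by
  rintro ⟨n, k, γ, p, c, _, _, _⟩ ⟨n', k', γ', p', c', _, _, _⟩ h
  have h' := encodeNats_injective h
  simp only [List.cons.injEq] at h'
  obtain ⟨rfl, h2⟩ := h'
  obtain ⟨rfl, h3⟩ := Fraction.toNats_append_inj h2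
  have h4 : (List.ofFn fun i => (p i, c i)) = List.ofFn fun i => (p' i, c' i) := by
    apply flatten_inj
    simpa [List.map_ofFn, Function.comp_def] using h3
  have hn : n = n' := by simpa using congrArg List.length h4
  subst hn
  have h5 := List.ofFn_injective h4
  obtain rfl : p = p' := funext fun i => congrArg Prod.fst (congrFun h5 i)
  obtain rfl : c = c' := funext fun i => congrArg Prod.snd (congrFun h5 i)
  rfl

/-- There is a Pareto cover `B ⊆ [0,1]ⁿ` of `μ_p` such that `|B| = k` and `E[c_B] ≤ γ`. -/
def IsYes (J : BinaryParetoInstance) : Prop :=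
  ∃ B : Finset (Cube J.n),
    IsParetoCover (bernoulliMeasure fun i => ((J.p i).val : ℝ)) B ∧
    B.card = J.k ∧
    ((expectedCost (bernoulliMeasure fun i => ((J.p i).val : ℝ))
      (fun i => ((J.c i).val : ℝ)) B : ℝ≥0∞) : EReal) ≤ (((J.γ.val : ℚ) : ℝ) : EReal)

end BinaryParetoInstance

/-- The decision variant of the binary Pareto cover problem. -/
def binaryParetoCover : DecisionProblem where
  Instance := BinaryParetoInstance
  encode := BinaryParetoInstance.encode
  encode_injective := BinaryParetoInstance.encode_injective
  IsYes := BinaryParetoInstance.IsYes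

end ParetoCover

/-! The measure is so concentrated that the unit vectors decide the matter. The origin has mass
almost 1, the unit vector e_i with i ≤ m has mass about a_i/M^4, and the points with last coordinate
1 or with two ones among the first m coordinates have total mass at most 1/M^6 + S^2/M^8 ≤ 2/M^6.

Given a partition into blocks of sum S/t, the cover consists of the origin, the all-ones point and
the indicator vectors of the t blocks. The origin costs 0, the unit vectors cost at most S/t each
and contribute at most S^2/(t M^4), and all other points cost at most S + 2M ≤ 3M and contribute at
most 6/M^5. This is `isYes_toPareto`.

Conversely, let B be a cover with t + 2 points and expected cost at most γ. A binary point with x_i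
= 1 lies below b only if b_i = 1, so fractional coordinates are useless and costs may be bounded
below by `floorCost`. The all-ones point is in B since it has positive mass
(`one_mem_of_isParetoCover`). Some point of B has no coordinate 1, as otherwise the origin is too
expensive (`exists_small`). Neither of the two serves a unit vector e_i, i ≤ m, most cheaply: the
latter does not cover it, and the former costs at least 2M (`exists_floorCost_lt`). Hence t points
remain for these unit vectors. If s_j is the sum of the a_i served by the j-th point, that point
costs at least s_j, so the expected cost is at least (1 - Σp)/M^4 · Σ s_j^2. As S/t is an integer
and Σ s_j^2 = S^2/t + Σ (s_j - S/t)^2, unequal s_j raise the sum of squares by at least 1, which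
exceeds the slack in γ (`bound_lt_of_lt`). So all s_j are equal and the assignment is a partition
(`isYes_of_toPareto`).

For the running time, a small structured language is compiled to `Turing.TM2` machines whose stacks
hold binary numerals. Every number that occurs in a register between routines has at most B = 12L +
24 digits for an input of length L (`values_lt`), and the program takes at most 1000 (B + 1)^2 steps
(`does_reduction`). -/

/-! ### Structured programs for stack machines -/

namespace StackProgram

/-- The elementary operations of a machine with stacks `K` over the alphabet `A` and internal
states `σ`. -/
inductive Op (K A σ : Type)
  | load (f : σ → σ)
  | push (k : K) (f : σ → A)
  | pop (k : K) (f : σ → Option A → σ)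
  | peek (k : K) (f : σ → Option A → σ)

/-- Structured programs: straight-line code, composition, case distinction, and a loop that runs
straight-line code before it tests its condition. -/
inductive Prog (K A σ : Type)
  | run (l : List (Op K A σ))
  | seq (P Q : Prog K A σ)
  | ite (c : σ → Bool) (P Q : Prog K A σ)
  | loop (l : List (Op K A σ)) (c : σ → Bool) (P : Prog K A σ)

variable {K A σ : Type}

/-- The statement that executes some operations and then continues with `q`. -/
def Op.stmts {Λ : Type} : List (Op K A σ) → Turing.TM2.Stmt (fun _ : K => A) Λ σ →
    Turing.TM2.Stmt (fun _ : K => A) Λ σ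
  | [], q => q
  | .load f :: l, q => .load f (Op.stmts l q)
  | .push k f :: l, q => .push k f (Op.stmts l q)
  | .pop k f :: l, q => .pop k f (Op.stmts l q)
  | .peek k f :: l, q => .peek k f (Op.stmts l q)

namespace Prog

/-- The labels of the compiled program. -/
def Label : Prog K A σ → Type
  | run _ => Unit
  | seq P Q => P.Label ⊕ Q.Label
  | ite _ P Q => Option (P.Label ⊕ Q.Label)
  | loop _ _ P => Option P.Label

instance instFintypeLabel : (P : Prog K A σ) → Fintype P.Label
  | run _ => inferInstanceAs (Fintype Unit)
  | seq P Q =>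
    have := instFintypeLabel P
    have := instFintypeLabel Q
    inferInstanceAs (Fintype (P.Label ⊕ Q.Label))
  | ite _ P Q =>
    have := instFintypeLabel P
    have := instFintypeLabel Q
    inferInstanceAs (Fintype (Option (P.Label ⊕ Q.Label)))
  | loop _ _ P =>
    have := instFintypeLabel P
    inferInstanceAs (Fintype (Option P.Label))

/-- The label at which the compiled program starts. -/
def entry : (P : Prog K A σ) → P.Label
  | run _ => ()
  | seq P _ => .inl P.entry
  | ite _ _ _ => none
  | loop _ _ _ => none

/-- The compiled program inside a machine with labels `Λ`, where `e` embeds the labels of the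
program and the machine continues at `next`. -/
def code {Λ : Type} : (P : Prog K A σ) → (P.Label → Λ) → Λ → P.Label →
    Turing.TM2.Stmt (fun _ : K => A) Λ σ
  | run l, _, next, _ => Op.stmts l (.goto fun _ => next)
  | seq P Q, e, _, .inl x => P.code (fun y => e (.inl y)) (e (.inr Q.entry)) x
  | seq _ Q, e, next, .inr x => Q.code (fun y => e (.inr y)) next x
  | ite c P Q, e, _, none =>
    .branch c (.goto fun _ => e (some (.inl P.entry))) (.goto fun _ => e (some (.inr Q.entry)))
  | ite _ P _, e, next, some (.inl x) => P.code (fun y => e (some (.inl y))) next x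
  | ite _ _ Q, e, next, some (.inr x) => Q.code (fun y => e (some (.inr y))) next x
  | loop l c P, e, next, none =>
    Op.stmts l (.branch c (.goto fun _ => e (some P.entry)) (.goto fun _ => next))
  | loop _ _ P, e, _, some x => P.code (fun y => e (some y)) (e none) x

end Prog

variable [DecidableEq K]

/-- The effect of an elementary operation on the internal state and the stacks. -/
def Op.exec : Op K A σ → σ × (K → List A) → σ × (K → List A)
  | .load f, s => (f s.1, s.2)
  | .push k f, s => (s.1, Function.update s.2 k (f s.1 :: s.2 k))
  | .pop k f, s => (f s.1 (s.2 k).head?, Function.update s.2 k (s.2 k).tail)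
  | .peek k f, s => (f s.1 (s.2 k).head?, s.2)

/-- The effect of straight-line code. -/
def Op.execs (l : List (Op K A σ)) (s : σ × (K → List A)) : σ × (K → List A) :=
  l.foldl (fun s o => o.exec s) s

@[simp] theorem Op.execs_nil (s : σ × (K → List A)) : Op.execs [] s = s := rfl

@[simp] theorem Op.execs_cons (o : Op K A σ) (l : List (Op K A σ)) (s : σ × (K → List A)) :
    Op.execs (o :: l) s = Op.execs l (o.exec s) := rfl

theorem Op.stepAux_stmts {Λ : Type} (l : List (Op K A σ))
    (q : Turing.TM2.Stmt (fun _ : K => A) Λ σ) (s : σ × (K → List A)) :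
    Turing.TM2.stepAux (Op.stmts l q) s.1 s.2 =
      Turing.TM2.stepAux q (Op.execs l s).1 (Op.execs l s).2 := by
  induction l generalizing s with
  | nil => rfl
  | cons o l ih =>
    cases o with
    | load f => exact ih (Op.exec (.load f) s)
    | push k f => exact ih (Op.exec (.push k f) s)
    | pop k f => exact ih (Op.exec (.pop k f) s)
    | peek k f => exact ih (Op.exec (.peek k f) s)

/-- The machine `M` gets from `c` to `d` in at most `n` steps. -/
def Reaches {Λ : Type} (M : Λ → Turing.TM2.Stmt (fun _ : K => A) Λ σ)
    (c d : Turing.TM2.Cfg (fun _ : K => A) Λ σ) (n : ℕ) : Prop :=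
  ∃ j ≤ n, (flip bind (Turing.TM2.step M))^[j] (some c) = some d

section Reaches

variable {Λ : Type} {M : Λ → Turing.TM2.Stmt (fun _ : K => A) Λ σ}
  {c d e : Turing.TM2.Cfg (fun _ : K => A) Λ σ} {m n : ℕ}

theorem Reaches.trans (h : Reaches M c d m) (h' : Reaches M d e n) : Reaches M c e (m + n) := by
  obtain ⟨i, hi, h⟩ := h
  obtain ⟨j, hj, h'⟩ := h'
  exact ⟨j + i, by omega, by rw [Function.iterate_add_apply, h, h']⟩

theorem Reaches.step (h : Turing.TM2.step M c = some d) : Reaches M c d 1 :=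
  ⟨1, le_rfl, h⟩

theorem Reaches.mono (h : Reaches M c d m) (hmn : m ≤ n) : Reaches M c d n := by
  obtain ⟨i, hi, h⟩ := h
  exact ⟨i, hi.trans hmn, h⟩

end Reaches

/-- In every machine that contains the compiled program `P`, the program transforms the internal
state and the stacks `s` into `s'` in at most `n` steps. -/
def Runs (P : Prog K A σ) (s s' : σ × (K → List A)) (n : ℕ) : Prop :=
  ∀ (Λ : Type) (M : Λ → Turing.TM2.Stmt (fun _ : K => A) Λ σ) (e : P.Label → Λ) (next : Λ),
    (∀ x, M (e x) = P.code e next x) →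
      Reaches M ⟨some (e P.entry), s.1, s.2⟩ ⟨some next, s'.1, s'.2⟩ n

section Runs

variable {P Q : Prog K A σ} {s s' s'' : σ × (K → List A)} {m n : ℕ} {c : σ → Bool}
  {l : List (Op K A σ)}

theorem Runs.mono (h : Runs P s s' m) (hmn : m ≤ n) : Runs P s s' n :=
  fun Λ M e next he => (h Λ M e next he).mono hmn

theorem Runs.of_eq (h : Runs P s s' m) (hs : s' = s'') (hmn : m ≤ n) : Runs P s s'' n :=
  hs ▸ h.mono hmn

/-- A machine step executes a whole statement up to its jump, so straight-line code costs a single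
step whatever its length. -/
theorem Runs.run : Runs (.run l) s (Op.execs l s) 1 := by
  intro Λ M e next he
  apply Reaches.step
  rw [Turing.TM2.step, he, Prog.code, Op.stepAux_stmts]
  rfl

theorem Runs.seq (h : Runs P s s' m) (h' : Runs Q s' s'' n) :
    Runs (.seq P Q) s s'' (m + n) := by
  intro Λ M e next he
  exact (h Λ M (fun x => e (.inl x)) (e (.inr Q.entry)) fun x => he _).trans
    (h' Λ M (fun x => e (.inr x)) next fun x => he _)

theorem Runs.ite_true (hc : c s.1 = true) (h : Runs P s s' n) :
    Runs (.ite c P Q) s s' (1 + n) := by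
  intro Λ M e next he
  refine Reaches.trans (Reaches.step ?_)
    (h Λ M (fun x => e (some (.inl x))) next fun x => he _)
  rw [Turing.TM2.step, he]
  simp [Prog.code, Prog.entry, hc]

theorem Runs.ite_false (hc : c s.1 = false) (h : Runs Q s s' n) :
    Runs (.ite c P Q) s s' (1 + n) := by
  intro Λ M e next he
  refine Reaches.trans (Reaches.step ?_)
    (h Λ M (fun x => e (some (.inr x))) next fun x => he _)
  rw [Turing.TM2.step, he]
  simp [Prog.code, Prog.entry, hc]

theorem Runs.loop_done (hc : c (Op.execs l s).1 = false) :
    Runs (.loop l c P) s (Op.execs l s) 1 := by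
  intro Λ M e next he
  refine Reaches.step ?_
  rw [Turing.TM2.step, he]
  simp [Prog.code, Prog.entry, Op.stepAux_stmts, hc]

/-- Peels off one round. Loops are verified by induction over such rounds, which builds an explicit
finite run, so no separate termination argument is needed. -/
theorem Runs.loop_next (hc : c (Op.execs l s).1 = true) (h : Runs P (Op.execs l s) s' m)
    (h' : Runs (.loop l c P) s' s'' n) : Runs (.loop l c P) s s'' (1 + m + n) := by
  intro Λ M e next he
  refine ((Reaches.step ?_).trans (h Λ M (fun x => e (some x)) (e none) fun x => he _)).trans
    (h' Λ M e next he)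
  rw [Turing.TM2.step, he]
  simp [Prog.code, Prog.entry, Op.stepAux_stmts, hc]

end Runs

/-- Whatever the internal state is, `P` transforms the stacks `S` into `S'` in at most `n` steps. -/
def Does (P : Prog K A σ) (S S' : K → List A) (n : ℕ) : Prop :=
  ∀ v, ∃ v', Runs P (v, S) (v', S') n

theorem Does.mono {P : Prog K A σ} {S S' : K → List A} {m n : ℕ} (h : Does P S S' m)
    (hmn : m ≤ n) : Does P S S' n := fun v =>
  let ⟨v', h'⟩ := h v
  ⟨v', h'.mono hmn⟩

theorem Does.of_eq {P : Prog K A σ} {S S' S'' : K → List A} {m n : ℕ} (h : Does P S S' m)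
    (hS : S' = S'') (hmn : m ≤ n) : Does P S S'' n := hS ▸ h.mono hmn

theorem Does.of_eq' {P : Prog K A σ} {S S' S'' : K → List A} {n : ℕ} (h : Does P S' S'' n)
    (hS : S = S') : Does P S S'' n := hS ▸ h

theorem Does.seq {P Q : Prog K A σ} {S S' S'' : K → List A} {m n : ℕ} (h : Does P S S' m)
    (h' : Does Q S' S'' n) : Does (.seq P Q) S S'' (m + n) := fun v =>
  let ⟨v', h₁⟩ := h v
  let ⟨v'', h₂⟩ := h' v'
  ⟨v'', h₁.seq h₂⟩

/-- The machine that runs `P` and stops in its initial state `v`. -/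
def Prog.machine [Fintype K] [Fintype A] [Fintype σ] (P : Prog K A σ) (i o : K) (v : σ) :
    Turing.FinTM2 where
  K := K
  k₀ := i
  k₁ := o
  Γ := fun _ => A
  Λ := Option P.Label
  main := some P.entry
  σ := σ
  initialState := v
  m
    | none => .load (fun _ => v) .halt
    | some x => P.code some none x

theorem Prog.initList_machine [Fintype K] [Fintype A] [Fintype σ] (P : Prog K A σ) (i o : K) (v : σ)
    (x : List A) : Turing.initList (P.machine i o v) x =
      ⟨some (some P.entry), v, Function.update (fun _ => []) i x⟩ := by
  refine congrArg (Turing.TM2.Cfg.mk (Γ := fun _ : K => A) (Λ := Option P.Label) (some (some P.entry)) v)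
    (funext fun k : K => ?_)
  rcases eq_or_ne k i with rfl | h
  · exact (dif_pos rfl).trans (Function.update_self (β := fun _ : K => List A) k x fun _ => []).symm
  · exact (dif_neg h).trans (Function.update_of_ne (β := fun _ : K => List A) h x fun _ => []).symm

/-- The halting configuration demands the initial internal state and empty stacks apart from the
output. This is why the machine resets its state before it halts and why programs have to clear
their registers. -/
theorem Prog.haltList_machine [Fintype K] [Fintype A] [Fintype σ] (P : Prog K A σ) (i o : K) (v : σ)
    (x : List A) : Turing.haltList (P.machine i o v) x =
      ⟨none, v, Function.update (fun _ => []) o x⟩ := by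
  refine congrArg (Turing.TM2.Cfg.mk (Γ := fun _ : K => A) (Λ := Option P.Label) none v)
    (funext fun k : K => ?_)
  rcases eq_or_ne k o with rfl | h
  · exact (dif_pos rfl).trans (Function.update_self (β := fun _ : K => List A) k x fun _ => []).symm
  · exact (dif_neg h).trans (Function.update_of_ne (β := fun _ : K => List A) h x fun _ => []).symm

/-- A structured program that maps every input word `ea a` to the output word `eb (f a)` in
polynomially many steps gives a polynomial-time machine. -/
theorem Prog.computableInPolyTime [Fintype K] [Fintype A] [Fintype σ] [Inhabited σ] {α β : Type}
    {ea : α → List A} {eb : β → List A} {f : α → β} (P : Prog K A σ) (i o : K) (T : Polynomial ℕ)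
    (h : ∀ a, Does P (Function.update (fun _ => []) i (ea a))
      (Function.update (fun _ => []) o (eb (f a))) (T.eval (ea a).length)) :
    Nonempty (Turing.TM2ComputableInPolyTime ea eb f) := by
  have key : ∀ a, Nonempty (Turing.TM2OutputsInTime (P.machine i o default) (ea a)
      (some (eb (f a))) ((T + 1).eval (ea a).length)) := by
    intro a
    obtain ⟨v', hv'⟩ := h a default
    have h1 := hv' (Option P.Label) (P.machine i o default).m some none fun x => rfl
    have h2 : Reaches (P.machine i o default).m
        ⟨some none, v', Function.update (fun _ => []) o (eb (f a))⟩
        ⟨none, default, Function.update (fun _ => []) o (eb (f a))⟩ 1 := Reaches.step rfl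
    obtain ⟨j, hj, h3⟩ := h1.trans h2
    refine ⟨⟨⟨j, ?_⟩, ?_⟩⟩
    · rw [initList_machine]
      exact h3.trans (congrArg some (haltList_machine P i o default _).symm)
    · simpa using hj
  exact ⟨{ tm := P.machine i o default
           inputAlphabet := Equiv.refl _
           outputAlphabet := Equiv.refl _
           time := T + 1
           outputsFun := fun a => by
            -- The machine uses the alphabet `A` itself; only the map along the identity equivalence
            -- has to be removed.
            have hi : List.map (Equiv.refl A).invFun (ea a) = ea a := List.map_id _
            have ho : List.map (Equiv.refl A).invFun (eb (f a)) = eb (f a) := List.map_id _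
            exact Eq.mpr (by exact congrArg₂ (fun x y => Turing.TM2OutputsInTime
              (P.machine i o default) x (some y) ((T + 1).eval (ea a).length)) hi ho)
              (key a).some }⟩

end StackProgram

/-! ### Binary numerals -/

namespace ParetoCover

/-- The binary numeral of `n`, least significant bit first. -/
def numeral (n : ℕ) : List Γ' := (encodeNat n).map Γ'.bit

theorem encodeNat_posNum (p : PosNum) : encodeNat (p : ℕ) = encodePosNum p := by
  rw [encodeNat, PosNum.of_to_nat, encodeNum]

@[simp] theorem numeral_zero : numeral 0 = [] := rfl

/-- The recursion by halving, from which the later facts on numerals follow. The three cases are the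
constructors of `PosNum`, through which `encodeNat` is defined. -/
theorem numeral_eq_cons {n : ℕ} (hn : n ≠ 0) :
    numeral n = Γ'.bit (decide (n % 2 = 1)) :: numeral (n / 2) := by
  obtain ⟨p, rfl⟩ : ∃ p : PosNum, (p : ℕ) = n := by
    rcases h : (n : Num) with _ | p
    · exact absurd (by rw [← Num.to_of_nat n, h]; rfl) hn
    · exact ⟨p, by rw [← Num.to_of_nat n, h]; rfl⟩
  unfold numeral
  cases p with
  | one => rfl
  | bit0 p =>
    rw [encodeNat_posNum, PosNum.cast_bit0, show ((p : ℕ) + p) % 2 = 0 by omega,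
      show ((p : ℕ) + p) / 2 = p by omega, encodeNat_posNum]
    rfl
  | bit1 p =>
    rw [encodeNat_posNum, PosNum.cast_bit1, show ((p : ℕ) + p + 1) % 2 = 1 by omega,
      show ((p : ℕ) + p + 1) / 2 = p by omega, encodeNat_posNum]
    rfl

theorem numeral_tail (n : ℕ) : (numeral n).tail = numeral (n / 2) := by
  rcases eq_or_ne n 0 with rfl | h
  · rfl
  · rw [numeral_eq_cons h]; rfl

theorem numeral_head? (n : ℕ) : (numeral n).head? =
    if n = 0 then none else some (Γ'.bit (decide (n % 2 = 1))) := by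
  split_ifs with h
  · rw [h]; rfl
  · rw [numeral_eq_cons h]; rfl

/-- Fails for 0, whose numeral is empty: a pushed zero bit would not be canonical. Hence the
nonvanishing hypotheses in the multiplication routines. -/
theorem numeral_two_mul {n : ℕ} (hn : n ≠ 0) : numeral (2 * n) = Γ'.bit false :: numeral n := by
  rw [numeral_eq_cons (by omega)]
  simp

theorem numeral_length_le {n B : ℕ} (h : n < 2 ^ B) : (numeral n).length ≤ B := by
  induction B generalizing n with
  | zero => simp [show n = 0 by simpa using h]
  | succ B ih =>
    rcases eq_or_ne n 0 with rfl | hn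
    · simp
    · rw [numeral_eq_cons hn]
      have := ih (n := n / 2) (by rw [pow_succ] at h; omega)
      simpa using this

theorem lt_two_pow_numeral_length (n : ℕ) : n < 2 ^ (numeral n).length := by
  induction n using Nat.strong_induction_on with
  | _ n ih =>
    rcases eq_or_ne n 0 with rfl | hn
    · simp
    · rw [numeral_eq_cons hn, List.length_cons, pow_succ]
      have := ih (n / 2) (by omega)
      omega

/-! ### Routines -/

open StackProgram

/-- The numerical registers of the machine. -/
inductive Reg
  | x | y | t | s | s2 | m | m2 | m4 | m5 | m6 | d | g | k
  deriving DecidableEq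

instance : Fintype Reg :=
  ⟨{.x, .y, .t, .s, .s2, .m, .m2, .m4, .m5, .m6, .d, .g, .k}, fun a => by cases a <;> decide⟩

/-- The stacks of the machine: input, output, the reversed list of numbers, two auxiliary contents,
and the registers. -/
inductive Stack
  | inp | out | rev | tmp | aux | reg (r : Reg)
  deriving DecidableEq

instance : Fintype Stack :=
  ⟨{.inp, .out, .rev, .tmp, .aux} ∪ Finset.univ.image Stack.reg, fun a => by cases a <;> simp⟩

/-- The internal states of the machine: the two symbols read last, and a carry. -/
abbrev Var : Type := Option Γ' × Option Γ' × Bool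

abbrev Program : Type := Prog Stack Γ' Var

/-- The contents of the stacks, where every register contains a binary numeral. -/
def contents (i o w t t' : List Γ') (r : Reg → ℕ) : Stack → List Γ'
  | .inp => i
  | .out => o
  | .rev => w
  | .tmp => t
  | .aux => t'
  | .reg a => numeral (r a)

section contents

variable (i o w t t' l : List Γ') (r : Reg → ℕ)

@[simp] theorem contents_inp : contents i o w t t' r .inp = i := rfl
@[simp] theorem contents_out : contents i o w t t' r .out = o := rfl
@[simp] theorem contents_rev : contents i o w t t' r .rev = w := rfl
@[simp] theorem contents_tmp : contents i o w t t' r .tmp = t := rfl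
@[simp] theorem contents_aux : contents i o w t t' r .aux = t' := rfl
@[simp] theorem contents_reg (a : Reg) : contents i o w t t' r (.reg a) = numeral (r a) := rfl

-- These rules bring every updated stack configuration back to the normal form `contents`, so that
-- `simp` can compare configurations.
@[simp] theorem update_contents_inp :
    Function.update (contents i o w t t' r) .inp l = contents l o w t t' r := by
  funext k; cases k <;> simp

@[simp] theorem update_contents_out :
    Function.update (contents i o w t t' r) .out l = contents i l w t t' r := by
  funext k; cases k <;> simp

@[simp] theorem update_contents_rev :
    Function.update (contents i o w t t' r) .rev l = contents i o l t t' r := by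
  funext k; cases k <;> simp

@[simp] theorem update_contents_tmp :
    Function.update (contents i o w t t' r) .tmp l = contents i o w l t' r := by
  funext k; cases k <;> simp

@[simp] theorem update_contents_aux :
    Function.update (contents i o w t t' r) .aux l = contents i o w t l r := by
  funext k; cases k <;> simp

@[simp] theorem update_contents_reg (a : Reg) (n : ℕ) :
    Function.update (contents i o w t t' r) (.reg a) (numeral n) =
      contents i o w t t' (Function.update r a n) := by
  funext k
  cases k with
  | reg b => by_cases h : b = a <;> simp [h]
  | _ => simp

@[simp] theorem update_contents_reg_nil (a : Reg) :
    Function.update (contents i o w t t' r) (.reg a) [] =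
      contents i o w t t' (Function.update r a 0) :=
  update_contents_reg i o w t t' r a 0

end contents

/-- Read a symbol. -/
def readSym (v : Var) (o : Option Γ') : Var := (o, v.2)

/-- Read a second symbol. -/
def readSym' (v : Var) (o : Option Γ') : Var := (v.1, o, v.2.2)

/-- Pop symbols from `a` until `c` fails for the symbol found, and push them on all `ds`. -/
def move (a : Stack) (c : Option Γ' → Bool) (ds : List Stack) : Program :=
  .loop [.pop a readSym] (fun v => c v.1) (.run (ds.map fun d => .push d fun v => v.1.getD .blank))

theorem execs_push (f : Var → Γ') (v : Var) {ds : List Stack} (hd : ds.Nodup)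
    (S : Stack → List Γ') : Op.execs (ds.map fun d => .push d f) (v, S) =
      (v, fun k => if k ∈ ds then f v :: S k else S k) := by
  induction ds generalizing S with
  | nil => simp
  | cons d ds ih =>
    rw [List.nodup_cons] at hd
    rw [List.map_cons, Op.execs_cons, Op.exec, ih hd.2]
    congr 1
    funext k
    by_cases h : k = d
    · subst h; simp [hd.1]
    · simp [h]

/-- Each symbol costs one test and one push. The symbol that fails the test has already been popped,
which explains `w.tail`; this is how separating commas get consumed. -/
theorem does_move {a : Stack} {c : Option Γ' → Bool} {ds : List Stack} (hd : ds.Nodup)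
    (ha : a ∉ ds) (u w : List Γ') (hu : ∀ x ∈ u, c (some x) = true) (hw : c w.head? = false)
    (S : Stack → List Γ') (hS : S a = u ++ w) :
    Does (move a c ds) S
      (fun k => if k = a then w.tail else if k ∈ ds then u.reverse ++ S k else S k)
      (2 * u.length + 1) := by
  induction u generalizing S with
  | nil =>
    intro v
    refine ⟨(Op.execs [.pop a readSym] (v, S)).1, ?_⟩
    have h := Runs.loop_done (P := .run (ds.map fun d => .push d fun v : Var => v.1.getD .blank))
      (l := [.pop a readSym]) (c := fun v : Var => c v.1) (s := (v, S))
      (by simpa [Op.exec, readSym, hS] using hw)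
    have e : (fun k => if k = a then w.tail else if k ∈ ds then [].reverse ++ S k else S k) =
        (Op.execs [.pop a readSym] (v, S)).2 := by
      ext k : 1
      rcases eq_or_ne k a with rfl | hk <;> simp [Op.exec, *]
    rw [e]
    exact h.mono le_add_self
  | cons x u ih =>
    intro v
    have hc : c (some x) = true := hu x (by simp)
    let S' : Stack → List Γ' := fun k => if k ∈ ds then x :: Function.update S a (u ++ w) k else
      Function.update S a (u ++ w) k
    obtain ⟨v', h'⟩ := ih (fun y hy => hu y (by simp [hy])) S' (by simp [S', ha]) (some x, v.2)
    have h1 : Runs (.run (ds.map fun d => .push d fun v : Var => v.1.getD .blank))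
        (Op.execs [.pop a readSym] (v, S)) ((some x, v.2), S') 1 := by
      have := Runs.run (l := ds.map fun d => .push d fun v : Var => v.1.getD .blank)
        (s := Op.execs [.pop a readSym] (v, S))
      simpa [execs_push _ _ hd, Op.exec, hS, readSym, S'] using this
    have h := Runs.loop_next (c := fun v : Var => c v.1)
      (by simpa [Op.exec, readSym, hS] using hc) h1 h'
    refine ⟨v', ?_⟩
    have e : (fun k => if k = a then w.tail else
        if k ∈ ds then (x :: u).reverse ++ S k else S k) =
        fun k => if k = a then w.tail else if k ∈ ds then u.reverse ++ S' k else S' k := by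
      ext k : 1
      rcases eq_or_ne k a with rfl | hk
      · simp
      · by_cases hk' : k ∈ ds <;> simp [hk, hk', S']
    rw [e]
    exact h.mono (by simp; omega)

end ParetoCover

namespace ParetoCover

open StackProgram

/-! ### Binary arithmetic on registers: copying, addition, multiplication -/

section Routines

variable {i o w t t' : List Γ'} {r : Reg → ℕ} {a b c : Reg} {B : ℕ}

/-- Set the register `a` to `0`. -/
def clear (a : Reg) : Program := move (.reg a) Option.isSome []

theorem does_clear (ha : r a < 2 ^ B) : Does (clear a) (contents i o w t t' r)
    (contents i o w t t' (Function.update r a 0)) (2 * B + 1) := by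
  refine (does_move (a := .reg a) List.nodup_nil (by simp) (numeral (r a)) [] (by simp) (by simp) _
    (by simp)).of_eq ?_ (by have := numeral_length_le ha; omega)
  funext k
  cases k with
  | reg c => by_cases h : c = a <;> simp [h]
  | _ => simp

theorem does_move_tmp (ha : r a < 2 ^ B) :
    Does (move (.reg a) Option.isSome [.tmp]) (contents i o w t t' r)
      (contents i o w ((numeral (r a)).reverse ++ t) t' (Function.update r a 0)) (2 * B + 1) := by
  refine (does_move (a := .reg a) (by simp) (by simp) (numeral (r a)) [] (by simp) (by simp) _
    (by simp)).of_eq ?_ (by have := numeral_length_le ha; omega)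
  funext k
  cases k with
  | reg c => by_cases h : c = a <;> simp [h]
  | _ => simp

theorem does_restore_tmp {n : ℕ} (ha : r a = 0) (hn : n < 2 ^ B) :
    Does (move .tmp Option.isSome [.reg a]) (contents i o w (numeral n).reverse t' r)
      (contents i o w [] t' (Function.update r a n)) (2 * B + 1) := by
  refine (does_move (a := .tmp) (by simp) (by simp) (numeral n).reverse [] (by simp) (by simp) _
    (by simp)).of_eq ?_ (by have := numeral_length_le hn; simp; omega)
  funext k
  cases k with
  | reg c => by_cases h : c = a <;> simp [h, ha]
  | _ => simp

theorem does_restore_aux {n : ℕ} (ha : r a = 0) (hn : n < 2 ^ B) :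
    Does (move .aux Option.isSome [.reg a]) (contents i o w t (numeral n).reverse r)
      (contents i o w t [] (Function.update r a n)) (2 * B + 1) := by
  refine (does_move (a := .aux) (by simp) (by simp) (numeral n).reverse [] (by simp) (by simp) _
    (by simp)).of_eq ?_ (by have := numeral_length_le hn; simp; omega)
  funext k
  cases k with
  | reg c => by_cases h : c = a <;> simp [h, ha]
  | _ => simp

/-- Copy the register `a` to the register `b`, which has to be `0`. -/
def copy (a b : Reg) : Program :=
  .seq (move (.reg a) Option.isSome [.tmp]) (move .tmp Option.isSome [.reg a, .reg b])

theorem does_copy (hab : a ≠ b) (hb : r b = 0) (ha : r a < 2 ^ B) :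
    Does (copy a b) (contents i o w [] t' r)
      (contents i o w [] t' (Function.update r b (r a))) (4 * B + 2) := by
  refine (does_move_tmp ha).seq (does_move (a := .tmp) (by simp [hab]) (by simp)
    (numeral (r a)).reverse [] (by simp) (by simp) _ (by simp)) |>.of_eq ?_
    (by have := numeral_length_le ha; simp; omega)
  funext k
  cases k with
  | reg c =>
    by_cases h : c = b
    · subst h; simp [hb, hab.symm]
    · by_cases h' : c = a <;> simp [h, h', hab]
  | _ => simp

/-- Write the numeral in the register `a`, followed by a comma, on the output stack. -/
def emit (a : Reg) : Program :=
  .seq (.run [.push .out fun _ => .comma])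
    (.seq (move (.reg a) Option.isSome [.tmp]) (move .tmp Option.isSome [.reg a, .out]))

/-- The top of the stack is the beginning of the word, so the comma is pushed before the digits. The
detour through `tmp` makes the least significant digit come out on top and restores the register. -/
theorem does_emit (ha : r a < 2 ^ B) :
    Does (emit a) (contents i o w [] t' r)
      (contents i (numeral (r a) ++ .comma :: o) w [] t' r) (4 * B + 3) := by
  have h0 : Does (.run [.push .out fun _ => .comma]) (contents i o w [] t' r)
      (contents i (.comma :: o) w [] t' r) 1 := fun v => ⟨v, by
    simpa [Op.exec] using Runs.run (l := [.push .out fun _ : Var => .comma])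
      (s := (v, contents i o w [] t' r))⟩
  refine h0.seq ((does_move_tmp ha).seq (does_move (a := .tmp) (by simp) (by simp)
    (numeral (r a)).reverse [] (by simp) (by simp) _ (by simp))) |>.of_eq ?_
    (by have := numeral_length_le ha; simp; omega)
  funext k
  cases k with
  | reg c => by_cases h' : c = a <;> simp [h']
  | _ => simp

/-- Push a word on a stack. -/
def pushWord (k : Stack) (u : List Γ') : Program :=
  .run (u.reverse.map fun x => .push k fun _ => x)

theorem does_pushWord (k : Stack) (u : List Γ') (S : Stack → List Γ') :
    Does (pushWord k u) S (Function.update S k (u ++ S k)) 1 := fun v => ⟨v, by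
  have key : ∀ (u : List Γ') (S : Stack → List Γ'), Op.execs
      (u.map fun x => .push k fun _ : Var => x) (v, S) =
      (v, Function.update S k (u.reverse ++ S k)) := by
    intro u
    induction u with
    | nil => simp
    | cons x u ih => intro S; simp [Op.exec, ih]
  refine Runs.run.of_eq ?_ le_rfl
  rw [key, List.reverse_reverse]⟩

theorem does_pushWord_reg (ha : r a = 0) (n : ℕ) : Does (pushWord (.reg a) (numeral n))
    (contents i o w t t' r) (contents i o w t t' (Function.update r a n)) 1 := by
  have := does_pushWord (.reg a) (numeral n) (contents i o w t t' r)
  simpa [ha] using this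

/-- The value of a bit that may be missing. -/
def isOne (x : Option Γ') : Bool := decide (x = some (.bit true))

/-- The loop that adds the numerals in `a` and `b`, and writes the reverse of the sum on `tmp` and
the reverse of the second numeral on `aux`. -/
def addLoop (a b : Reg) : Program :=
  .loop [.pop (.reg a) readSym, .pop (.reg b) readSym']
    (fun v => v.1.isSome || v.2.1.isSome || v.2.2)
    (.seq (.run [.push .tmp fun v => .bit (isOne v.1 ^^ isOne v.2.1 ^^ v.2.2),
        .load fun v => (v.1, v.2.1,
          isOne v.1 && isOne v.2.1 || isOne v.1 && v.2.2 || isOne v.2.1 && v.2.2)])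
      (.ite (fun v => v.2.1.isSome) (.run [.push .aux fun v => v.2.1.getD .blank]) (.run [])))

theorem isOne_head?_numeral (n : ℕ) : isOne (numeral n).head? = decide (n % 2 = 1) := by
  rw [numeral_head?, isOne]
  split_ifs with h <;> simp [h]

theorem xor_eq_parity (m n : ℕ) (d : Bool) : (decide (m % 2 = 1) ^^ (decide (n % 2 = 1) ^^ d)) =
    decide ((m + n + d.toNat) % 2 = 1) := by
  rw [Nat.add_mod, Nat.add_mod m]
  rcases Nat.mod_two_eq_zero_or_one m with h | h <;>
  rcases Nat.mod_two_eq_zero_or_one n with h' | h' <;>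
  cases d <;> simp [h, h']

theorem majority_eq {m n : ℕ} {d d' : Bool} (h : d'.toNat = (m % 2 + n % 2 + d.toNat) / 2) :
    (decide (m % 2 = 1) && decide (n % 2 = 1) || decide (m % 2 = 1) && d ||
      decide (n % 2 = 1) && d) = d' := by
  rcases Nat.mod_two_eq_zero_or_one m with h₁ | h₁ <;>
  rcases Nat.mod_two_eq_zero_or_one n with h₂ | h₂ <;>
  cases d <;> cases d' <;> simp [h₁, h₂] at h ⊢

/-- One round of a ripple-carry adder. The loop continues exactly while the remaining total, carry
included, is nonzero, so the sum gets no leading zeros. A digit of the second summand is saved only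
if it exists, so this numeral stays canonical too. -/
theorem runs_addLoop_next (hab : a ≠ b) (v : Option Γ' × Option Γ') (d d' : Bool)
    (h0 : r a + r b + d.toNat ≠ 0) (hd : d'.toNat = (r a % 2 + r b % 2 + d.toNat) / 2)
    {s : Var × (Stack → List Γ')} {n : ℕ}
    (h : ∀ v' : Option Γ' × Option Γ', Runs (addLoop a b) ((v'.1, v'.2, d'), contents i o w
      (.bit (decide ((r a + r b + d.toNat) % 2 = 1)) :: t)
      (if r b = 0 then t' else .bit (decide (r b % 2 = 1)) :: t')
      (Function.update (Function.update r a (r a / 2)) b (r b / 2))) s n) :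
    Runs (addLoop a b) ((v.1, v.2, d), contents i o w t t' r) s (4 + n) := by
  have h1 := Runs.run (l := [.push .tmp fun v : Var => .bit (isOne v.1 ^^ isOne v.2.1 ^^ v.2.2),
        .load fun v : Var => (v.1, v.2.1,
          isOne v.1 && isOne v.2.1 || isOne v.1 && v.2.2 || isOne v.2.1 && v.2.2)])
    (s := Op.execs [.pop (.reg a) readSym, .pop (.reg b) readSym']
      ((v.1, v.2, d), contents i o w t t' r))
  have e : Op.execs [.push .tmp fun v : Var => .bit (isOne v.1 ^^ isOne v.2.1 ^^ v.2.2),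
        .load fun v : Var => (v.1, v.2.1,
          isOne v.1 && isOne v.2.1 || isOne v.1 && v.2.2 || isOne v.2.1 && v.2.2)]
      (Op.execs [.pop (.reg a) readSym, .pop (.reg b) readSym']
        ((v.1, v.2, d), contents i o w t t' r)) =
      (((numeral (r a)).head?, (numeral (r b)).head?, d'), contents i o w
      (.bit (decide ((r a + r b + d.toNat) % 2 = 1)) :: t) t'
      (Function.update (Function.update r a (r a / 2)) b (r b / 2))) := by
    simp [Op.exec, readSym, readSym', numeral_tail, isOne_head?_numeral, hab.symm, xor_eq_parity, majority_eq hd]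
  rw [e] at h1
  have h2 : Runs (.ite (fun v : Var => v.2.1.isSome)
      (.run [.push .aux fun v => v.2.1.getD .blank]) (.run []))
      (((numeral (r a)).head?, (numeral (r b)).head?, d'), contents i o w
      (.bit (decide ((r a + r b + d.toNat) % 2 = 1)) :: t) t'
      (Function.update (Function.update r a (r a / 2)) b (r b / 2)))
      (((numeral (r a)).head?, (numeral (r b)).head?, d'), contents i o w
      (.bit (decide ((r a + r b + d.toNat) % 2 = 1)) :: t)
      (if r b = 0 then t' else .bit (decide (r b % 2 = 1)) :: t')
      (Function.update (Function.update r a (r a / 2)) b (r b / 2))) 2 := by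
    by_cases hb : r b = 0
    · refine (Runs.ite_false (by simp [hb]) Runs.run).of_eq ?_ le_rfl
      simp [hb]
    · refine (Runs.ite_true (by simp [hb, numeral_head?]) Runs.run).of_eq ?_ le_rfl
      simp [hb, Op.exec, numeral_head?]
  refine (Runs.loop_next ?_ (h1.seq h2) (h (_, _))).mono (by omega)
  simp only [Op.exec, readSym, readSym', Op.execs_cons, Op.execs_nil, contents_reg, numeral_head?,
    numeral_tail, update_contents_reg, Function.update_of_ne hab.symm]
  by_cases ha : r a = 0
  · by_cases hb : r b = 0
    · cases d
      · simp [ha, hb] at h0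
      · simp
    · simp [hb]
  · simp [ha]

/-- Induction on the digit bound: after a round the remaining total is the floor of half the old
one. A round takes 4 steps; one extra round for a final carry and the last test give 4B + 5. -/
theorem runs_addLoop (hab : a ≠ b) (v : Option Γ' × Option Γ') (d : Bool)
    (ha : r a < 2 ^ B) (hb : r b < 2 ^ B) :
    Runs (addLoop a b) ((v.1, v.2, d), contents i o w t t' r)
      ((none, none, false), contents i o w ((numeral (r a + r b + d.toNat)).reverse ++ t)
        ((numeral (r b)).reverse ++ t') (Function.update (Function.update r a 0) b 0))
      (4 * B + 5) := by
  have done : ∀ (v : Option Γ' × Option Γ') (t t' : List Γ') (r : Reg → ℕ), r a = 0 → r b = 0 →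
      Runs (addLoop a b) ((v.1, v.2, false), contents i o w t t' r)
        ((none, none, false), contents i o w t t' r) 1 := by
    intro v t t' r h h'
    have e : Op.execs [.pop (.reg a) readSym, .pop (.reg b) readSym']
        ((v.1, v.2, false), contents i o w t t' r) =
        ((none, none, false), contents i o w t t' r) := by
      have e₁ : Function.update r a 0 = r := by rw [← h, Function.update_eq_self]
      have e₂ : Function.update r b 0 = r := by rw [← h', Function.update_eq_self]
      simp [Op.exec, readSym, readSym', h, h', e₁, e₂]
    exact (Runs.loop_done (by rw [e]; rfl)).of_eq e le_rfl
  induction B generalizing v d t t' r with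
  | zero =>
    have h : r a = 0 := by simpa using ha
    have h' : r b = 0 := by simpa using hb
    cases d with
    | false =>
      refine (done v t t' r h h').of_eq ?_ (by omega)
      have e₁ : Function.update r a 0 = r := by rw [← h, Function.update_eq_self]
      have e₂ : Function.update r b 0 = r := by rw [← h', Function.update_eq_self]
      simp [h, h', e₁, e₂]
    | true =>
      refine (runs_addLoop_next hab v true false (by simp) (by simp [h, h'])
        fun v' => done v' _ _ _ (by simp [h, hab]) (by simp [h'])).of_eq ?_ le_rfl
      simp [h, h', numeral_eq_cons]
  | succ B ih =>
    by_cases h0 : r a + r b + d.toNat = 0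
    · have h : r a = 0 := by omega
      have h' : r b = 0 := by omega
      have hd : d = false := by cases d <;> simp at h0 ⊢
      subst hd
      refine (done v t t' r h h').of_eq ?_ (by omega)
      have e₁ : Function.update r a 0 = r := by rw [← h, Function.update_eq_self]
      have e₂ : Function.update r b 0 = r := by rw [← h', Function.update_eq_self]
      simp [h, h', e₁, e₂]
    · obtain ⟨d', hd'⟩ : ∃ d' : Bool, d'.toNat = (r a % 2 + r b % 2 + d.toNat) / 2 := by
        have := Bool.toNat_le d
        rcases (by omega : (r a % 2 + r b % 2 + d.toNat) / 2 = 0 ∨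
          (r a % 2 + r b % 2 + d.toNat) / 2 = 1) with h | h
        · exact ⟨false, h.symm⟩
        · exact ⟨true, h.symm⟩
      rw [pow_succ] at ha hb
      have hr : ∀ n n' : ℕ, Function.update (Function.update (Function.update (Function.update
          r a n) b n') a 0) b 0 = Function.update (Function.update r a 0) b 0 := by
        intro n n'
        funext c
        by_cases h : c = b <;> by_cases h' : c = a <;> simp [h, h', hab]
      have key := fun v' => ih (r := Function.update (Function.update r a (r a / 2)) b (r b / 2))
        (t := .bit (decide ((r a + r b + d.toNat) % 2 = 1)) :: t)
        (t' := if r b = 0 then t' else .bit (decide (r b % 2 = 1)) :: t') v' d'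
        (by simp [hab]; omega) (by simp; omega)
      refine (runs_addLoop_next hab v d d' h0 hd' key).of_eq ?_ (by omega)
      have e : r a / 2 + r b / 2 + d'.toNat = (r a + r b + d.toNat) / 2 := by omega
      rw [hr, numeral_eq_cons h0]
      simp only [Function.update_self, Function.update_of_ne hab, e, List.reverse_cons,
        List.append_assoc, List.singleton_append]
      split_ifs with h
      · simp [h]
      · simp [numeral_eq_cons h]

/-- Add the register `b` to the register `a`. -/
def add (a b : Reg) : Program :=
  .seq (.run [.load fun v => (v.1, v.2.1, false)]) (.seq (addLoop a b)
    (.seq (move .tmp Option.isSome [.reg a]) (move .aux Option.isSome [.reg b])))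

theorem does_add (hab : a ≠ b) (ha : r a < 2 ^ B) (hb : r b < 2 ^ B) :
    Does (add a b) (contents i o w [] [] r)
      (contents i o w [] [] (Function.update r a (r a + r b))) (8 * B + 10) := by
  intro v
  have h1 := runs_addLoop (i := i) (o := o) (w := w) (t := []) (t' := []) hab (v.1, v.2.1) false
    ha hb
  simp only [Bool.toNat_false, add_zero, List.append_nil] at h1
  -- The sum may have one digit more than the summands, hence the bound `B + 1`.
  obtain ⟨v', h2⟩ := ((does_restore_tmp (t' := (numeral (r b)).reverse) (i := i) (o := o) (w := w)
    (r := Function.update (Function.update r a 0) b 0) (a := a) (n := r a + r b) (B := B + 1)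
    (by simp [hab]) (by rw [pow_succ]; omega)).seq
      (does_restore_aux (r := Function.update (Function.update (Function.update r a 0) b 0) a
        (r a + r b)) (a := b) (by simp [hab.symm]) hb)) (none, none, false)
  refine ⟨v', (Runs.seq (Runs.run (l := [.load fun v => (v.1, v.2.1, false)]))
    (Runs.seq h1 h2)).of_eq ?_ (by omega)⟩
  congr 2
  funext c
  by_cases h : c = b
  · subst h; simp [hab.symm]
  · by_cases h' : c = a <;> simp [h, h', hab]

theorem does_nil (S : Stack → List Γ') : Does (.run [] : Program) S S 1 :=
  fun v => ⟨v, Runs.run⟩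

/-- The loop that adds the product of the registers `x` and `y` to the register `a`. -/
def mulAddLoop (a : Reg) : Program :=
  .loop [.pop (.reg .y) readSym] (fun v => v.1.isSome)
    (.seq (.ite (fun v => isOne v.1) (add a .x) (.run [])) (pushWord (.reg .x) [.bit false]))

/-- Add the product of the registers `x` and `y` to the register `a`, and set `x` and `y` to
`0`. -/
def mulAdd (a : Reg) : Program := .seq (mulAddLoop a) (clear .x)

/-- Shift-and-add: a round replaces y by ⌊y/2⌋ and x by 2x and keeps a + x·y invariant. The bound on
x·2^j keeps x below 2^B through all remaining doublings; its final value is irrelevant, as it is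
cleared afterwards. -/
theorem does_mulAddLoop (hax : a ≠ .x) (hay : a ≠ .y) {j : ℕ} (hx : r .x ≠ 0)
    (hy : r .y < 2 ^ j) (hB : r .x * 2 ^ j < 2 ^ B) (ha : r a + r .x * r .y < 2 ^ B) :
    ∃ x, x < 2 ^ B ∧ Does (mulAddLoop a) (contents i o w [] [] r)
      (contents i o w [] [] (Function.update (Function.update (Function.update r
        a (r a + r .x * r .y)) .y 0) .x x)) (j * (8 * B + 13) + 1) := by
  induction j generalizing r with
  | zero =>
    have h0 : r .y = 0 := by simpa using hy
    refine ⟨r .x, by simpa using hB, fun v => ⟨(none, v.2), ?_⟩⟩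
    refine (Runs.loop_done ?_).of_eq ?_ (by omega)
    · simp [Op.exec, readSym, h0]
    · have e₁ : Function.update r .y 0 = r := by rw [← h0, Function.update_eq_self]
      simp [Op.exec, readSym, h0, e₁]
  | succ j ih =>
    have hxB : r .x < 2 ^ B := lt_of_le_of_lt (Nat.le_mul_of_pos_right _ (by positivity)) hB
    by_cases h0 : r .y = 0
    · refine ⟨r .x, hxB, fun v => ⟨(none, v.2), ?_⟩⟩
      refine (Runs.loop_done ?_).of_eq ?_ (by omega)
      · simp [Op.exec, readSym, h0]
      · have e₁ : Function.update r .y 0 = r := by rw [← h0, Function.update_eq_self]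
        simp [Op.exec, readSym, h0, e₁]
    · have hy2 := Nat.div_add_mod (r .y) 2
      have hprod : r a + r .x * (r .y % 2) + 2 * r .x * (r .y / 2) = r a + r .x * r .y := by
        conv_rhs => rw [← hy2]
        ring
      obtain ⟨x, hx', h⟩ := ih (r := Function.update (Function.update (Function.update r .y
        (r .y / 2)) a (r a + r .x * (r .y % 2))) .x (2 * r .x)) (by simpa using hx)
        (by rw [pow_succ] at hy; simp [hay.symm]; omega)
        (by rw [pow_succ] at hB; simpa [mul_assoc, mul_comm, mul_left_comm] using hB)
        (by simpa [hax, hay.symm, hprod] using ha)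
      refine ⟨x, hx', fun v => ?_⟩
      have h1 : ∃ v', Runs (.ite (fun v => isOne v.1) (add a .x) (.run []))
          (((numeral (r .y)).head?, v.2), contents i o w [] [] (Function.update r .y (r .y / 2)))
          (v', contents i o w [] [] (Function.update (Function.update r .y
            (r .y / 2)) a (r a + r .x * (r .y % 2)))) (8 * B + 11) := by
        rcases Nat.mod_two_eq_zero_or_one (r .y) with h | h
        · refine ⟨((numeral (r .y)).head?, v.2), (Runs.ite_false (by simp [isOne_head?_numeral, h]) Runs.run).of_eq ?_
            (by omega)⟩
          have e₁ : Function.update (Function.update r .y (r .y / 2)) a (r a) =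
              Function.update r .y (r .y / 2) := by
            rw [Function.update_eq_self_iff, Function.update_of_ne hay]
          simp [h, e₁]
        · obtain ⟨v', h'⟩ := does_add (i := i) (o := o) (w := w) (a := a) (b := .x) (B := B)
            (r := Function.update r .y (r .y / 2)) hax (by simp [hay]; omega) (by simpa using hxB)
            ((numeral (r .y)).head?, v.2)
          refine ⟨v', (Runs.ite_true (by simp [isOne_head?_numeral, h]) h').of_eq ?_ (by omega)⟩
          simp [h, hay]
      obtain ⟨v₁, h1⟩ := h1
      obtain ⟨v₂, h2⟩ := does_pushWord (.reg .x) [.bit false] (contents i o w [] []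
        (Function.update (Function.update r .y (r .y / 2)) a (r a + r .x * (r .y % 2)))) v₁
      have e2 : Function.update (contents i o w [] []
        (Function.update (Function.update r .y (r .y / 2)) a (r a + r .x * (r .y % 2))))
        (.reg .x) ([.bit false] ++ contents i o w [] []
        (Function.update (Function.update r .y (r .y / 2)) a (r a + r .x * (r .y % 2)))
        (.reg .x)) = contents i o w [] [] (Function.update (Function.update (Function.update r .y
        (r .y / 2)) a (r a + r .x * (r .y % 2))) .x (2 * r .x)) := by
        rw [← update_contents_reg (a := .x), numeral_two_mul hx]
        simp [hax.symm]
      rw [e2] at h2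
      obtain ⟨v₃, h3⟩ := h v₂
      have e3 : Op.execs [.pop (.reg .y) readSym] (v, contents i o w [] [] r) =
          (((numeral (r .y)).head?, v.2),
            contents i o w [] [] (Function.update r .y (r .y / 2))) := by
        simp [Op.exec, readSym, numeral_tail]
      have h4 := h1.seq h2
      rw [← e3] at h4
      refine ⟨v₃, (Runs.loop_next ?_ h4 h3).of_eq ?_ (by ring_nf; omega)⟩
      · simp [e3, numeral_head?, h0]
      · congr 2
        funext c
        by_cases h : c = .x
        · subst h; simp
        · by_cases h' : c = .y
          · subst h'; simp [hay.symm]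
          · by_cases h'' : c = a <;> simp [h, h', h'', hax, hay, hay.symm, hprod]

theorem does_mulAdd (hax : a ≠ .x) (hay : a ≠ .y) (hx : r .x ≠ 0) (hxB : r .x < 2 ^ B)
    (hy : r .y < 2 ^ B) (ha : r a < 2 ^ B) : Does (mulAdd a) (contents i o w [] [] r)
      (contents i o w [] [] (Function.update (Function.update (Function.update r
        a (r a + r .x * r .y)) .y 0) .x 0)) (30 * (B + 1) ^ 2) := by
  -- Doubling x at most B times stays below 2^(2B), and adding the old value of the register `a` to
  -- the product costs one more bit. So the loop is applied with the digit bound 2B + 1.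
  have h2 : r .x * 2 ^ B < 2 ^ (2 * B + 1) := by
    rw [pow_succ, two_mul, pow_add]
    nlinarith [Nat.two_pow_pos B]
  obtain ⟨x, hx', h⟩ := does_mulAddLoop (i := i) (o := o) (w := w) hax hay hx hy h2 (by
    rw [pow_succ, two_mul, pow_add]
    nlinarith [Nat.two_pow_pos B])
  refine (h.seq (does_clear (by simpa using hx'))).of_eq ?_ (by nlinarith)
  simp

end Routines

end ParetoCover

namespace ParetoCover

open StackProgram

/-! ### The program for the reduction and its running time -/

section Reduction

variable {i o w t t' : List Γ'} {r : Reg → ℕ} {a b c : Reg} {B : ℕ}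

theorem encodeNats_cons (n : ℕ) (l : List ℕ) :
    encodeNats (n :: l) = numeral n ++ .comma :: encodeNats l := by
  simp [encodeNats, numeral]

/-- Whether a symbol is a bit. -/
def isBit : Option Γ' → Bool
  | some (.bit _) => true
  | _ => false

theorem isBit_of_mem_numeral {n : ℕ} {x : Γ'} (hx : x ∈ numeral n) : isBit (some x) = true := by
  obtain ⟨b, -, rfl⟩ := List.mem_map.1 hx
  rfl

/-- Read a number from the input and store it in the register `t`. -/
def readFirst : Program :=
  .seq (move .inp isBit [.tmp]) (move .tmp Option.isSome [.reg .t])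

theorem does_readFirst (ht : r .t = 0) {n : ℕ} (hn : n < 2 ^ B) (l : List ℕ) :
    Does readFirst (contents (encodeNats (n :: l)) o w [] [] r)
      (contents (encodeNats l) o w [] [] (Function.update r .t n)) (4 * B + 2) := by
  have hl := numeral_length_le hn
  have h1 := (does_move (a := .inp) (ds := [.tmp]) (by simp) (by simp) (numeral n)
    (.comma :: encodeNats l) (fun x hx => isBit_of_mem_numeral hx) rfl
    (contents (encodeNats (n :: l)) o w [] [] r) (encodeNats_cons n l)).of_eq
    (S'' := contents (encodeNats l) o w (numeral n).reverse [] r)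
    (by funext k; cases k <;> simp) (n := 2 * B + 1) (by omega)
  exact (h1.seq (does_restore_tmp ht hn)).mono (by omega)

/-- The loop only peeks at its stack, since the symbol found belongs to the next number and has to
be left for the body. -/
theorem does_peekLoop_done {k : Stack} {P : Program} {S : Stack → List Γ'} (h : S k = []) :
    Does (.loop [.peek k readSym] (fun v => v.1.isSome) P) S S 1 := fun v =>
  ⟨(none, v.2), (Runs.loop_done (by simp [Op.exec, readSym, h])).of_eq
    (by simp [Op.exec, readSym, h]) le_rfl⟩

theorem does_peekLoop_next {k : Stack} {P : Program} {S S' S'' : Stack → List Γ'} {m n : ℕ}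
    (h : S k ≠ []) (hP : Does P S S' m)
    (hS : Does (.loop [.peek k readSym] (fun v => v.1.isSome) P) S' S'' n) :
    Does (.loop [.peek k readSym] (fun v => v.1.isSome) P) S S'' (1 + m + n) := fun v => by
  obtain ⟨x, u, hx⟩ := List.exists_cons_of_ne_nil h
  obtain ⟨v₁, h₁⟩ := hP (some x, v.2)
  obtain ⟨v₂, h₂⟩ := hS v₁
  have e : Op.execs [.peek k readSym] (v, S) = ((some x, v.2), S) := by
    simp [Op.exec, readSym, hx]
  rw [← e] at h₁
  exact ⟨v₂, Runs.loop_next (by rw [e]; rfl) h₁ h₂⟩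

/-- Read all remaining numbers from the input, store them in reverse order on the stack `rev`, and
add them to the register `s`. -/
def readAll : Program :=
  .loop [.peek .inp readSym] (fun v => v.1.isSome) <|
    .seq (pushWord .rev [.comma]) <| .seq (move .inp isBit [.tmp, .rev]) <|
    .seq (move .tmp Option.isSome [.reg .x]) <| .seq (add .s .x) (clear .x)

/-- The word for a list of numbers on the stack `rev`, for the reversed list. -/
def reverseNats (l : List ℕ) : List Γ' := l.flatMap fun n => (numeral n).reverse ++ [.comma]

/-- The last number read ends up on top of `rev`, most significant digit first and with its comma
below. Popping it digit by digit onto a register therefore restores the numeral. -/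
theorem does_readAll (hx : r .x = 0) (l : List ℕ) (hl : r .s + l.sum < 2 ^ B) :
    Does readAll (contents (encodeNats l) o w [] [] r)
      (contents [] o (reverseNats l.reverse ++ w) [] [] (Function.update r .s (r .s + l.sum)))
      (l.length * (14 * B + 15) + 1) := by
  induction l generalizing r w with
  | nil =>
    refine (does_peekLoop_done rfl).of_eq ?_ (by omega)
    simp [encodeNats, reverseNats]
  | cons n l ih =>
    rw [List.sum_cons] at hl
    have hn : n < 2 ^ B := by omega
    have hlen := numeral_length_le hn
    have h1 : Does (pushWord .rev [.comma]) (contents (encodeNats (n :: l)) o w [] [] r)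
        (contents (encodeNats (n :: l)) o (.comma :: w) [] [] r) 1 :=
      (does_pushWord _ _ _).of_eq (by simp) le_rfl
    have h2 := (does_move (a := .inp) (ds := [.tmp, .rev]) (by simp) (by simp) (numeral n)
      (.comma :: encodeNats l) (fun x hx => isBit_of_mem_numeral hx) rfl
      (contents (encodeNats (n :: l)) o (.comma :: w) [] [] r) (encodeNats_cons n l)).of_eq
      (S'' := contents (encodeNats l) o ((numeral n).reverse ++ .comma :: w)
        (numeral n).reverse [] r)
      (by funext k; cases k <;> simp) (n := 2 * B + 1) (by omega)
    have h3 := h1.seq <| h2.seq <| (does_restore_tmp hx hn).seq <|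
      (does_add (a := .s) (b := .x) (B := B) (by decide) (by simp; omega) (by simpa using hn)).seq <|
      does_clear (B := B) (a := .x) (by simpa using hn)
    have e : Function.update (Function.update (Function.update r .x n) .s
        (Function.update r .x n .s + Function.update r .x n .x)) .x 0 =
        Function.update r .s (r .s + n) := by
      funext a; cases a <;> simp [hx]
    rw [e] at h3
    refine (does_peekLoop_next (by simp [encodeNats_cons]) h3
      (ih (w := (numeral n).reverse ++ .comma :: w) (r := Function.update r .s (r .s + n))
        (by simpa using hx) (by simp; omega))).of_eq ?_ ?_
    · simp [reverseNats, add_assoc]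
    · simp only [List.length_cons]
      ring_nf
      omega

/-- Add the product of the registers `a` and `b` to the register `c`. -/
def mul (a b c : Reg) : Program :=
  .seq (copy a .x) <| .seq (copy b .y) (mulAdd c)

theorem does_mul (hx : r .x = 0) (hy : r .y = 0) (hax : a ≠ .x) (hbx : b ≠ .x) (hby : b ≠ .y)
    (hcx : c ≠ .x) (hcy : c ≠ .y) (ha : r a ≠ 0) (haB : r a < 2 ^ B) (hbB : r b < 2 ^ B)
    (hcB : r c < 2 ^ B) : Does (mul a b c) (contents i o w [] [] r)
      (contents i o w [] [] (Function.update r c (r c + r a * r b))) (40 * (B + 1) ^ 2) := by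
  refine ((does_copy hax hx haB).seq <| (does_copy (r := Function.update r .x (r a)) hby
    (by simpa using hy) (by simpa [hbx] using hbB)).seq <| does_mulAdd (B := B) hcx hcy (by simpa)
    (by simpa) (by simpa [hbx]) (by simpa [hcx, hcy])).of_eq ?_ (by nlinarith)
  congr 1
  funext e
  by_cases h1 : e = .x
  · subst h1; simp [hx, hcx.symm]
  · by_cases h2 : e = .y
    · subst h2; simp [hy, hcy.symm]
    · by_cases h3 : e = c
      · subst h3; simp [h1, h2, hbx]
      · simp [h1, h2, h3]

/-- Add `n` times the register `a` to the register `c`. -/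
def mulConst (n : ℕ) (a c : Reg) : Program :=
  .seq (copy a .x) <| .seq (pushWord (.reg .y) (numeral n)) (mulAdd c)

theorem does_mulConst {n : ℕ} (hx : r .x = 0) (hy : r .y = 0) (hax : a ≠ .x)
    (hcx : c ≠ .x) (hcy : c ≠ .y) (ha : r a ≠ 0) (haB : r a < 2 ^ B) (hnB : n < 2 ^ B)
    (hcB : r c < 2 ^ B) : Does (mulConst n a c) (contents i o w [] [] r)
      (contents i o w [] [] (Function.update r c (r c + r a * n))) (40 * (B + 1) ^ 2) := by
  refine ((does_copy hax hx haB).seq <| (does_pushWord_reg (r := Function.update r .x (r a))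
    (by simpa using hy) n).seq <| does_mulAdd (B := B) hcx hcy (by simpa)
    (by simpa) (by simpa) (by simpa [hcx, hcy])).of_eq ?_ (by nlinarith)
  congr 1
  funext e
  by_cases h1 : e = .x
  · subst h1; simp [hx, hcx.symm]
  · by_cases h2 : e = .y
    · subst h2; simp [hy, hcy.symm]
    · by_cases h3 : e = c
      · subst h3; simp [h1, h2]
      · simp [h1, h2, h3]

/-- The final values of the registers, in terms of the input `t` and the sum `S`. -/
def values (t S : ℕ) : Reg → ℕ
  | .x => 0
  | .y => 0
  | .t => t
  | .s => S
  | .s2 => S ^ 2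
  | .m => 13 * S ^ 2
  | .m2 => (13 * S ^ 2) ^ 2
  | .m4 => (13 * S ^ 2) ^ 4
  | .m5 => (13 * S ^ 2) ^ 5
  | .m6 => (13 * S ^ 2) ^ 6
  | .d => t * (13 * S ^ 2) ^ 5
  | .g => S ^ 2 * (13 * S ^ 2) + 6 * t
  | .k => t + 2

/-- The order in which the registers are computed. -/
def stage : Reg → ℕ
  -- The scratch registers `x` and `y` are 0 between routines. Their stage lies beyond all stages
  -- that are reached, so they are never the register to be computed next.
  | .x => 12
  | .y => 12
  | .t => 1
  | .s => 1
  | .s2 => 2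
  | .m => 3
  | .m2 => 4
  | .m4 => 5
  | .m5 => 6
  | .m6 => 7
  | .d => 8
  | .g => 9
  | .k => 10

/-- The values of the registers after some stage. -/
def valuesAt (t S n : ℕ) (a : Reg) : ℕ := if stage a ≤ n then values t S a else 0

theorem update_valuesAt {t S n v : ℕ} (c : Reg) (hc : ∀ a, stage a = n + 1 ↔ a = c)
    (hv : v = values t S c) :
    Function.update (valuesAt t S n) c v = valuesAt t S (n + 1) := by
  subst hv
  funext a
  by_cases h : a = c
  · subst h; simp [valuesAt, ((hc a).2 rfl).le]
  · have h' : stage a ≠ n + 1 := fun h' => h ((hc a).1 h')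
    have : stage a ≤ n ↔ stage a ≤ n + 1 := by omega
    simp [valuesAt, h, this]

/-- Compute all registers from `t` and `s`. -/
def compute : Program :=
  .seq (mul .s .s .s2) <| .seq (mulConst 13 .s2 .m) <| .seq (mul .m .m .m2) <|
  .seq (mul .m2 .m2 .m4) <| .seq (mul .m4 .m .m5) <| .seq (mul .m5 .m .m6) <|
  .seq (mul .t .m5 .d) <| .seq (.seq (mul .s2 .m .g) (mulConst 6 .t .g)) <|
  .seq (copy .t .k) <| .seq (pushWord (.reg .x) (numeral 2)) <| .seq (add .k .x) (clear .x)

/-- A product step of `compute`: both factors are available by stage n, and the target is the only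
register of stage n + 1, so it still holds 0. -/
theorem does_mul_stage {t S n : ℕ} (hB : ∀ a, values t S a < 2 ^ B) (hn : n < 12)
    (hax : a ≠ .x) (hbx : b ≠ .x) (hby : b ≠ .y)
    (hcx : c ≠ .x) (hcy : c ≠ .y) (ha : stage a ≤ n) (ha0 : values t S a ≠ 0) (hb : stage b ≤ n)
    (hc : ∀ a, stage a = n + 1 ↔ a = c) (hv : values t S a * values t S b = values t S c) :
    Does (mul a b c) (contents i o w [] [] (valuesAt t S n))
      (contents i o w [] [] (valuesAt t S (n + 1))) (40 * (B + 1) ^ 2) := by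
  have hc' : valuesAt t S n c = 0 := if_neg (by rw [(hc c).2 rfl]; omega)
  have ha' : valuesAt t S n a = values t S a := if_pos ha
  have hb' : valuesAt t S n b = values t S b := if_pos hb
  have := does_mul (i := i) (o := o) (w := w) (B := B) (r := valuesAt t S n) (a := a) (b := b)
    (c := c) (if_neg (by simp [stage]; omega)) (if_neg (by simp [stage]; omega)) hax hbx hby hcx hcy
    (by rwa [ha']) (by rw [ha']; exact hB a) (by rw [hb']; exact hB b) (by rw [hc']; positivity)
  rwa [update_valuesAt c hc (by rw [hc', ha', hb', hv, zero_add])] at this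

theorem does_compute {t S : ℕ} (ht : 0 < t) (hS : 0 < S) (hB : ∀ a, values t S a < 2 ^ B)
    (h13 : 13 < 2 ^ B) : Does compute (contents i o w [] [] (valuesAt t S 1))
      (contents i o w [] [] (values t S)) (500 * (B + 1) ^ 2) := by
  have hm : Does (mulConst 13 .s2 .m) (contents i o w [] [] (valuesAt t S 2))
      (contents i o w [] [] (valuesAt t S 3)) (40 * (B + 1) ^ 2) := by
    have := does_mulConst (i := i) (o := o) (w := w) (B := B) (r := valuesAt t S 2) (a := .s2)
      (c := .m) (n := 13) rfl rfl (by decide) (by decide) (by decide)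
      (by simp [valuesAt, stage, values]; omega) (hB .s2) h13 (by simp [valuesAt, stage])
    rwa [update_valuesAt .m (by rintro ⟨⟩ <;> decide)
      (by simp [valuesAt, stage, values, mul_comm])] at this
  have hg : Does (.seq (mul .s2 .m .g) (mulConst 6 .t .g))
      (contents i o w [] [] (valuesAt t S 8))
      (contents i o w [] [] (valuesAt t S 9)) (40 * (B + 1) ^ 2 + 40 * (B + 1) ^ 2) := by
    have h1 := does_mul (i := i) (o := o) (w := w) (B := B) (r := valuesAt t S 8) (a := .s2)
      (b := .m) (c := .g) rfl rfl (by decide) (by decide) (by decide) (by decide) (by decide)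
      (by simp [valuesAt, stage, values]; omega) (hB .s2) (hB .m) (by simp [valuesAt, stage])
    have h2 := does_mulConst (i := i) (o := o) (w := w) (B := B) (r := Function.update
      (valuesAt t S 8) .g (valuesAt t S 8 .g + valuesAt t S 8 .s2 * valuesAt t S 8 .m)) (a := .t)
      (c := .g) (n := 6) rfl rfl (by decide) (by decide) (by decide)
      (ne_of_gt ht) (hB .t) (by omega) (by
        have := hB .g
        simp [valuesAt, stage, values] at this ⊢; omega)
    exact h1.seq (h2.of_eq (congrArg (contents i o w [] []) ((Function.update_idem ..).trans
      (update_valuesAt (n := 8) .g (by rintro ⟨⟩ <;> decide)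
        (by simp [valuesAt, stage, values, mul_comm])))) le_rfl)
  have hk1 := does_copy (i := i) (o := o) (w := w) (t' := []) (r := valuesAt t S 9) (a := .t)
    (b := .k) (B := B) (by decide) rfl (hB .t)
  have hk2 := does_pushWord_reg (i := i) (o := o) (w := w) (t := []) (t' := []) (a := .x)
    (r := Function.update (valuesAt t S 9) .k (valuesAt t S 9 .t)) rfl 2
  have hk3 := (does_add (i := i) (o := o) (w := w) (B := B) (a := .k) (b := .x)
    (r := Function.update (Function.update (valuesAt t S 9) .k (valuesAt t S 9 .t)) .x 2)
    (by decide) (by exact hB .t) (by simp; omega)).seq (does_clear (B := B) (a := .x) (by simp; omega))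
  have e : Function.update (Function.update (Function.update (Function.update (valuesAt t S 9) .k
      (valuesAt t S 9 .t)) .x 2) .k (Function.update (Function.update (valuesAt t S 9) .k
      (valuesAt t S 9 .t)) .x 2 .k + Function.update (Function.update (valuesAt t S 9) .k
      (valuesAt t S 9 .t)) .x 2 .x)) .x 0 = values t S := by
    funext a
    cases a <;> simp [valuesAt, stage, values]
  rw [e] at hk3
  refine ((does_mul_stage (n := 1) hB ?_ ?_ ?_ ?_ ?_ ?_ ?_ ?_ ?_ ?_ ?_).seq <| hm.seq <|
    (does_mul_stage (n := 3) hB ?_ ?_ ?_ ?_ ?_ ?_ ?_ ?_ ?_ ?_ ?_).seq <|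
    (does_mul_stage (n := 4) hB ?_ ?_ ?_ ?_ ?_ ?_ ?_ ?_ ?_ ?_ ?_).seq <|
    (does_mul_stage (n := 5) hB ?_ ?_ ?_ ?_ ?_ ?_ ?_ ?_ ?_ ?_ ?_).seq <|
    (does_mul_stage (n := 6) hB ?_ ?_ ?_ ?_ ?_ ?_ ?_ ?_ ?_ ?_ ?_).seq <|
    (does_mul_stage (n := 7) hB ?_ ?_ ?_ ?_ ?_ ?_ ?_ ?_ ?_ ?_ ?_).seq <|
    hg.seq <| hk1.seq <| hk2.seq hk3).mono (by nlinarith)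
  all_goals first
    | decide
    | (simp only [values]; positivity)
    | rintro ⟨⟩
    | (simp only [values] <;> ring)

/-- Write the number `n` and a comma on the output stack. -/
def emitConst (n : ℕ) : Program := pushWord .out (encodeNats [n])

theorem does_emitConst (n : ℕ) (l : List ℕ) :
    Does (emitConst n) (contents i (encodeNats l) w t t' r)
      (contents i (encodeNats (n :: l)) w t t' r) 1 :=
  (does_pushWord _ _ _).of_eq (by simp [encodeNats_cons]; simp [encodeNats]) le_rfl

theorem does_emit_encodeNats (a : Reg) (ha : r a < 2 ^ B) (l : List ℕ) :
    Does (emit a) (contents i (encodeNats l) w [] t' r)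
      (contents i (encodeNats (r a :: l)) w [] t' r) (4 * B + 3) := by
  rw [encodeNats_cons]
  exact does_emit ha

/-- Write twice the register `a`, followed by a comma, on the output stack. -/
def emitDouble (a : Reg) : Program := .seq (emit a) (pushWord .out [.bit false])

theorem does_emitDouble (a : Reg) (ha : r a < 2 ^ B) (ha0 : r a ≠ 0) (l : List ℕ) :
    Does (emitDouble a) (contents i (encodeNats l) w [] t' r)
      (contents i (encodeNats (2 * r a :: l)) w [] t' r) (4 * B + 4) :=
  ((does_emit ha).seq (does_pushWord _ _ _)).of_eq
    (by simp [encodeNats_cons, numeral_two_mul ha0]) le_rfl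

/-- For every number `n` on the stack `rev`, write `n / m4` and `n / 1` on the output stack. -/
def writeAll : Program :=
  .loop [.peek .rev readSym] (fun v => v.1.isSome) <|
    .seq (move .rev isBit [.reg .x]) <|
    .seq (emitConst 1) <| .seq (emit .x) <| .seq (emitConst 0) <|
    .seq (emit .m4) <| .seq (emit .x) <| .seq (emitConst 0) (clear .x)

/-- The numbers that encode `n / D` and `n / 1` for all `n` in a list. -/
def fractionNats (D : ℕ) (l : List ℕ) : List ℕ := l.flatMap fun n => [0, n, D, 0, n, 1]

/-- The output word grows from its end, so the six numbers of each item are emitted backwards. Since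
`rev` has the last number on top, the original order is restored. -/
theorem does_writeAll (hx : r .x = 0) (hD : r .m4 < 2 ^ B) (l : List ℕ) (hl : ∀ n ∈ l, n < 2 ^ B)
    (l' : List ℕ) : Does writeAll (contents i (encodeNats l') (reverseNats l) [] [] r)
      (contents i (encodeNats (fractionNats (r .m4) l.reverse ++ l')) [] [] [] r)
      (l.length * (16 * B + 15) + 1) := by
  induction l generalizing l' with
  | nil => exact (does_peekLoop_done rfl).of_eq (by simp [fractionNats, reverseNats]) (by omega)
  | cons n l ih =>
    have hn : n < 2 ^ B := hl n (by simp)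
    have hlen := numeral_length_le hn
    have h1 := (does_move (a := .rev) (ds := [.reg .x]) (by simp) (by simp) (numeral n).reverse
      (.comma :: reverseNats l) (fun x hx => isBit_of_mem_numeral (List.mem_reverse.1 hx)) rfl
      (contents i (encodeNats l') (reverseNats (n :: l)) [] [] r) (by simp [reverseNats])).of_eq
      (S'' := contents i (encodeNats l') (reverseNats l) [] [] (Function.update r .x n))
      (by
        funext k
        cases k with
        | reg a => by_cases h : a = .x <;> simp [h, hx]
        | _ => simp) (n := 2 * B + 1) (by simp; omega)
    have hxB : Function.update r .x n .x < 2 ^ B := by simpa using hn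
    have hDB : Function.update r .x n .m4 < 2 ^ B := by simpa using hD
    have h2 := h1.seq <| (does_emitConst 1 _).seq <| (does_emit_encodeNats .x hxB _).seq <|
      (does_emitConst 0 _).seq <| (does_emit_encodeNats .m4 hDB _).seq <|
      (does_emit_encodeNats .x hxB _).seq <| (does_emitConst 0 _).seq <| does_clear hxB
    refine (does_peekLoop_next (by simp [reverseNats]) h2 ((ih (fun k hk => hl k (by simp [hk]))
      ([0, n, r .m4, 0, n, 1] ++ l')).of_eq' ?_)).of_eq ?_ ?_
    · simp [← hx]
    · simp [fractionNats]
    · simp only [List.length_cons]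
      ring_nf
      omega

/-- Set all registers in a list to `0`. -/
def clearAll : List Reg → Program
  | [] => .run []
  | a :: l => .seq (clear a) (clearAll l)

theorem does_clearAll (l : List Reg) (h : ∀ a, r a < 2 ^ B) :
    Does (clearAll l) (contents i o w t t' r)
      (contents i o w t t' fun a => if a ∈ l then 0 else r a) (l.length * (2 * B + 1) + 1) := by
  induction l generalizing r with
  | nil => exact (does_nil _).of_eq (by simp) (by omega)
  | cons a l ih =>
    refine ((does_clear (h a)).seq (ih fun b => ?_)).of_eq (congrArg _ (funext fun b => ?_)) ?_
    · by_cases hb : b = a <;> simp [hb, h]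
    · by_cases hb : b = a <;> simp [hb]
    · simp only [List.length_cons]
      ring_nf
      omega

/-- The program that computes the reduction. -/
def reduction : Program :=
  .seq readFirst <| .seq readAll <| .seq compute <|
  .seq (emitConst 1) <| .seq (emitDouble .m) <| .seq (emitConst 0) <|
  .seq (emit .m6) <| .seq (emitConst 1) <| .seq (emitConst 0) <| .seq writeAll <|
  .seq (emit .d) <| .seq (emit .g) <| .seq (emitConst 0) <| .seq (emit .k) <|
  clearAll [.t, .s, .s2, .m, .m2, .m4, .m5, .m6, .d, .g, .k]

/-- The numbers in the output of the reduction. -/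
def outputNats (t : ℕ) (l : List ℕ) : List ℕ :=
  (t + 2) :: 0 :: (l.sum ^ 2 * (13 * l.sum ^ 2) + 6 * t) :: (t * (13 * l.sum ^ 2) ^ 5) ::
    (fractionNats ((13 * l.sum ^ 2) ^ 4) l ++
      [0, 1, (13 * l.sum ^ 2) ^ 6, 0, 2 * (13 * l.sum ^ 2), 1])

/-- The routines are chained, the output being written from its last number to its first.
Multiplication is quadratic in B, and the linear-time loops run at most B times, so the total is
quadratic. The registers `x` and `y` are missing in the final clearing because they are 0 already.
-/
theorem does_reduction {t : ℕ} {l : List ℕ} (ht : 0 < t) (hl : 0 < l.sum)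
    (hB : ∀ a, values t l.sum a < 2 ^ B) (h13 : 13 < 2 ^ B) (hlen : l.length ≤ B) :
    Does reduction (Function.update (fun _ => []) .inp (encodeNats (t :: l)))
      (Function.update (fun _ => []) .out (encodeNats (outputNats t l)))
      (1000 * (B + 1) ^ 2) := by
  have e0 : Function.update (fun _ => []) .inp (encodeNats (t :: l)) =
      contents (encodeNats (t :: l)) [] [] [] [] fun _ => 0 := by
    funext k; cases k <;> simp
  have e1 : Function.update (Function.update (fun _ => 0) .t t) .s l.sum =
      valuesAt t l.sum 1 := by
    funext a; cases a <;> simp [valuesAt, stage, values]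
  have h1 := does_readFirst (B := B) (o := []) (w := []) (r := fun _ => 0) rfl (hB .t) l
  have h2 := (does_readAll (B := B) (o := []) (w := []) (r := Function.update (fun _ => 0) .t t)
    rfl l (by simpa [values] using hB .s)).of_eq
    (S'' := contents [] (encodeNats []) (reverseNats l.reverse) [] [] (valuesAt t l.sum 1))
    (by simp [← e1, encodeNats]) le_rfl
  have hM : values t l.sum .m ≠ 0 := by simp only [values]; positivity
  have hl' : ∀ n ∈ l.reverse, n < 2 ^ B := fun n hn =>
    (List.single_le_sum (by simp) n (List.mem_reverse.1 hn)).trans_lt (hB .s)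
  rw [e0]
  refine (h1.seq <| h2.seq <| (does_compute ht hl hB h13).seq <|
    (does_emitConst 1 _).seq <| (does_emitDouble .m (hB .m) hM _).seq <| (does_emitConst 0 _).seq <|
    (does_emit_encodeNats .m6 (hB .m6) _).seq <| (does_emitConst 1 _).seq <|
    (does_emitConst 0 _).seq <| (does_writeAll (B := B) rfl (hB .m4) l.reverse hl' _).seq <|
    (does_emit_encodeNats .d (hB .d) _).seq <| (does_emit_encodeNats .g (hB .g) _).seq <|
    (does_emitConst 0 _).seq <| (does_emit_encodeNats .k (hB .k) _).seq <|
    does_clearAll _ hB).of_eq ?_ ?_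
  · funext k
    cases k with
    | reg a => cases a <;> simp [values]
    | out => simp [outputNats, values]
    | _ => simp
  · simp only [List.length_reverse, List.length_cons, List.length_nil]
    have : l.length * (14 * B + 15) ≤ B * (14 * B + 15) := Nat.mul_le_mul_right _ hlen
    have : l.length * (16 * B + 15) ≤ B * (16 * B + 15) := Nat.mul_le_mul_right _ hlen
    nlinarith

/-- Each comma contributes a factor 2, which pays for adding one more summand: n + s < 2^(u + v + 1)
if n < 2^u and s < 2^v. -/
theorem le_two_pow_encodeNats_length (l : List ℕ) :
    l.sum < 2 ^ (encodeNats l).length ∧ l.length ≤ (encodeNats l).length := by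
  induction l with
  | nil => simp [encodeNats]
  | cons n l ih =>
    rw [encodeNats_cons]
    have hn := lt_two_pow_numeral_length n
    simp only [List.sum_cons, List.length_append, List.length_cons]
    refine ⟨?_, by omega⟩
    rw [← add_assoc, pow_succ, pow_add]
    nlinarith [ih.1, Nat.two_pow_pos (numeral n).length, Nat.two_pow_pos (encodeNats l).length]

/-- From 13 < 2^4 follows M < 2^(2L + 4), and M^6 needs the most digits: 6(2L + 4) = 12L + 24. -/
theorem values_lt {t S L : ℕ} (hS : 0 < S) (htL : t < 2 ^ L) (hSL : S < 2 ^ L)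
    (a : Reg) : values t S a < 2 ^ (12 * L + 24) := by
  have hM0 : 0 < 13 * S ^ 2 := by positivity
  have hM : 13 * S ^ 2 < 2 ^ (2 * L + 4) := by
    have : S ^ 2 < (2 ^ L) ^ 2 := Nat.pow_lt_pow_left hSL two_ne_zero
    rw [pow_add, pow_mul']
    omega
  have hM6 : (13 * S ^ 2) ^ 6 < 2 ^ (12 * L + 24) := by
    calc (13 * S ^ 2) ^ 6 < (2 ^ (2 * L + 4)) ^ 6 := Nat.pow_lt_pow_left hM (by norm_num)
      _ = 2 ^ (12 * L + 24) := by rw [← pow_mul]; congr 1; ring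
  have hpow : ∀ k ≤ 6, (13 * S ^ 2) ^ k < 2 ^ (12 * L + 24) := fun k hk =>
    (Nat.pow_le_pow_right hM0 hk).trans_lt hM6
  have hle : ∀ k ≤ 12 * L + 24, 2 ^ k ≤ 2 ^ (12 * L + 24) := fun k hk =>
    Nat.pow_le_pow_right two_pos hk
  have hL := hle L (by omega)
  have hL1 := hle (L + 2) (by omega)
  rw [pow_add] at hL1
  have hS2 : S ^ 2 ≤ 13 * S ^ 2 := by omega
  cases a with
  | x => simp [values]
  | y => simp [values]
  | t => exact htL.trans_le hL
  | s => exact hSL.trans_le hL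
  | s2 => exact hS2.trans_lt (by simpa using hpow 1 (by norm_num))
  | m => simpa [values] using hpow 1 (by norm_num)
  | m2 => exact hpow 2 (by norm_num)
  | m4 => exact hpow 4 (by norm_num)
  | m5 => exact hpow 5 (by norm_num)
  | m6 => exact hpow 6 (by norm_num)
  | d =>
    calc t * (13 * S ^ 2) ^ 5 < 2 ^ L * (2 ^ (2 * L + 4)) ^ 5 :=
          Nat.mul_lt_mul_of_lt_of_le htL (Nat.pow_le_pow_left hM.le 5) (by positivity)
      _ = 2 ^ (11 * L + 20) := by rw [← pow_mul, ← pow_add]; congr 1; ring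
      _ ≤ _ := hle _ (by omega)
  | g =>
    have h1 : S ^ 2 * (13 * S ^ 2) ≤ 2 ^ (4 * L + 8) := by
      calc S ^ 2 * (13 * S ^ 2) ≤ 2 ^ (2 * L + 4) * 2 ^ (2 * L + 4) :=
            Nat.mul_le_mul (hS2.trans hM.le) hM.le
        _ = _ := by rw [← pow_add]; congr 1; ring
    have h2 : 6 * t < 2 ^ (4 * L + 8) := by
      calc 6 * t < 2 ^ 8 * 2 ^ L := by omega
        _ = 2 ^ (L + 8) := by rw [← pow_add, add_comm]
        _ ≤ _ := Nat.pow_le_pow_right two_pos (by omega)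
    calc S ^ 2 * (13 * S ^ 2) + 6 * t < 2 ^ (4 * L + 9) := by
          rw [pow_succ 2 (4 * L + 8)]; omega
      _ ≤ _ := hle _ (by omega)
  | k =>
    have := hle (L + 2) (by omega)
    have h1 : 1 ≤ 2 ^ L := Nat.one_le_two_pow
    simp only [values]
    rw [pow_add] at this
    omega

end Reduction

end ParetoCover

namespace ParetoCover

/-! ### The reduction -/

namespace NumberPartitioningInstance

variable (I : NumberPartitioningInstance)

/-- The sum of all numbers. -/
def sum : ℕ := ∑ i, I.a i

theorem sum_pos : 0 < I.sum :=
  Finset.sum_pos (fun i _ => I.a_pos i) ⟨⟨0, I.m_pos⟩, Finset.mem_univ _⟩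

theorem le_sum (i : Fin I.m) : I.a i ≤ I.sum :=
  Finset.single_le_sum (f := I.a) (fun _ _ => Nat.zero_le _) (Finset.mem_univ i)

/-- The large number `M` of the reduction. -/
def big : ℕ := 13 * I.sum ^ 2

theorem big_pos : 0 < I.big := by
  have := I.sum_pos
  unfold big
  positivity

theorem sum_le_big : I.sum ≤ I.big := by
  have := I.sum_pos
  unfold big
  nlinarith

/-- The instance of the binary Pareto cover problem that belongs to an instance of
NUMBER PARTITIONING. -/
def toPareto : BinaryParetoInstance where
  n := I.m + 1
  k := I.t + 2
  γ := ⟨(I.sum ^ 2 * I.big + 6 * I.t : ℕ), I.t * I.big ^ 5,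
    Nat.mul_pos I.t_pos (pow_pos I.big_pos 5)⟩
  p := Fin.snoc (α := fun _ => Fraction) (fun i => ⟨I.a i, I.big ^ 4, pow_pos I.big_pos 4⟩)
    ⟨1, I.big ^ 6, pow_pos I.big_pos 6⟩
  c := Fin.snoc (α := fun _ => Fraction) (fun i => ⟨I.a i, 1, one_pos⟩)
    ⟨(2 * I.big : ℕ), 1, one_pos⟩
  k_pos := by omega
  p_mem i := by
    have hM : (1 : ℚ) ≤ I.big := by exact_mod_cast I.big_pos
    refine Fin.lastCases ?_ (fun i => ?_) i
    · simp only [Fin.snoc_last, Fraction.val, Set.mem_Icc]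
      push_cast
      exact ⟨by positivity, div_le_one_of_le₀ (one_le_pow₀ hM) (by positivity)⟩
    · simp only [Fin.snoc_castSucc, Fraction.val, Set.mem_Icc]
      push_cast
      have h1 : (I.a i : ℚ) ≤ I.big := by exact_mod_cast (I.le_sum i).trans I.sum_le_big
      exact ⟨by positivity, div_le_one_of_le₀ (h1.trans (le_self_pow₀ hM (by norm_num)))
        (by positivity)⟩
  c_nonneg i := by
    refine Fin.lastCases ?_ (fun i => ?_) i
    · simp only [Fin.snoc_last, Fraction.val]
      positivity
    · simp only [Fin.snoc_castSucc, Fraction.val]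
      positivity

theorem encode_toPareto :
    I.toPareto.encode = encodeNats (outputNats I.t (List.ofFn I.a)) := by
  have hsum : (List.ofFn I.a).sum = I.sum := List.sum_ofFn
  have key : (List.ofFn fun i => (I.toPareto.p i).toNats ++ (I.toPareto.c i).toNats).flatten =
      fractionNats (I.big ^ 4) (List.ofFn I.a) ++ [0, 1, I.big ^ 6, 0, 2 * I.big, 1] := by
    have h : (List.ofFn fun i : Fin (I.m + 1) =>
        (I.toPareto.p i).toNats ++ (I.toPareto.c i).toNats) =
        (List.ofFn I.a).map (fun n => [0, n, I.big ^ 4, 0, n, 1]) ++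
          [[0, 1, I.big ^ 6, 0, 2 * I.big, 1]] := by
      rw [List.ofFn_succ', List.map_ofFn, List.concat_eq_append]
      simp only [toPareto, Fin.snoc_castSucc, Fin.snoc_last]
      congr 1
    have h' : (List.ofFn fun i => (I.toPareto.p i).toNats ++ (I.toPareto.c i).toNats) =
        (List.ofFn fun i : Fin (I.m + 1) =>
          (I.toPareto.p i).toNats ++ (I.toPareto.c i).toNats) := rfl
    rw [h', h, fractionNats, List.flatMap_def]
    simp
  rw [BinaryParetoInstance.encode, key, outputNats, hsum]
  rfl

end NumberPartitioningInstance

/-- The reduction can be computed in polynomial time. -/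
theorem toPareto_computable : Nonempty (Turing.TM2ComputableInPolyTime
    NumberPartitioningInstance.encode BinaryParetoInstance.encode
    NumberPartitioningInstance.toPareto) := by
  -- This polynomial is 1000 (B + 1)^2 with the digit bound B = 12L + 24 of `values_lt`.
  refine reduction.computableInPolyTime .inp .out
    (Polynomial.C 1000 * (Polynomial.C 12 * Polynomial.X + Polynomial.C 25) ^ 2) fun I => ?_
  have hsum : (List.ofFn I.a).sum = I.sum := List.sum_ofFn
  obtain ⟨h1, h2⟩ := le_two_pow_encodeNats_length (I.t :: List.ofFn I.a)
  rw [List.sum_cons, hsum] at h1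
  rw [List.length_cons] at h2
  rw [I.encode_toPareto]
  have := does_reduction (B := 12 * (encodeNats (I.t :: List.ofFn I.a)).length + 24) I.t_pos
    (hsum ▸ I.sum_pos) (by rw [hsum]; exact values_lt I.sum_pos (by omega) (by omega))
    ((by norm_num : 13 < 2 ^ 24).trans_le (Nat.pow_le_pow_right two_pos (by omega))) (by omega)
  simpa [NumberPartitioningInstance.encode, add_assoc] using this

end ParetoCover

namespace ParetoCover

/-! ### Bernoulli measures and covers -/

section Bernoulli

variable {n : ℕ} {p c : Fin n → ℝ} {B : Finset (Cube n)}

/-- The mass of the point `x` under `μ_p`. -/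
noncomputable def weight (p : Fin n → ℝ) (x : Fin n → Bool) : ℝ :=
  ∏ i, if x i then p i else 1 - p i

theorem bernoulliMeasure_eq (p : Fin n → ℝ) : bernoulliMeasure p =
    ∑ x : Fin n → Bool, ENNReal.ofReal (weight p x) • Measure.dirac (binaryPoint x) := by
  unfold bernoulliMeasure weight
  simp [Finset.prod_ite]

theorem weight_nonneg (hp : ∀ i, p i ∈ Set.Icc (0 : ℝ) 1) (x : Fin n → Bool) :
    0 ≤ weight p x := by
  refine Finset.prod_nonneg fun i _ => ?_
  split_ifs
  · exact (hp i).1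
  · linarith [(hp i).2]

/-- The probability that all coordinates in `T` are `1`. -/
theorem sum_weight (p : Fin n → ℝ) (T : Finset (Fin n)) :
    ∑ x, weight p x * (if ∀ i ∈ T, x i = true then 1 else 0) = ∏ i ∈ T, p i := by
  have h : ∀ x : Fin n → Bool, weight p x * (if ∀ i ∈ T, x i = true then 1 else 0) =
      ∏ i, if x i then p i else if i ∈ T then 0 else 1 - p i := by
    intro x
    split_ifs with hx
    · rw [mul_one]
      refine Finset.prod_congr rfl fun i _ => ?_
      by_cases hi : i ∈ T
      · simp [hx i hi]
      · simp [hi]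
    · push Not at hx
      obtain ⟨i, hi, hxi⟩ := hx
      rw [mul_zero, Finset.prod_eq_zero (Finset.mem_univ i)]
      simp [hxi, hi]
  simp_rw [h]
  -- The sum over all binary points of a product over coordinates factorizes; a coordinate outside
  -- `T` contributes p i + (1 - p i) = 1.
  rw [← Fintype.piFinset_univ, ← Finset.prod_univ_sum (fun _ => Finset.univ)
    (fun i (b : Bool) => if b then p i else if i ∈ T then 0 else 1 - p i)]
  rw [← Finset.prod_subset (Finset.subset_univ T)]
  · exact Finset.prod_congr rfl fun i hi => by simp [hi]
  · intro i _ hi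
    simp [hi]

theorem sum_weight_eq_one (p : Fin n → ℝ) : ∑ x, weight p x = 1 := by
  simpa using sum_weight p ∅

theorem expectedCost_eq (p c : Fin n → ℝ) (B : Finset (Cube n)) :
    expectedCost (bernoulliMeasure p) c B =
      ∑ x, ENNReal.ofReal (weight p x) * coverCost c B (binaryPoint x) := by
  simp [expectedCost, bernoulliMeasure_eq, lintegral_smul_measure]

theorem isParetoCover_of_one_mem (hp : ∀ i, p i ∈ Set.Icc (0 : ℝ) 1) (hB : 1 ∈ B) :
    IsParetoCover (bernoulliMeasure p) B := by
  have h : {x : Cube n | ∃ b ∈ B, x ≤ b} = Set.univ :=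
    Set.eq_univ_of_forall fun x => ⟨1, hB, fun i => unitInterval.le_one'⟩
  rw [IsParetoCover, h, bernoulliMeasure_eq]
  simp only [Measure.coe_finsetSum, Finset.sum_apply, Measure.smul_apply, measure_univ,
    smul_eq_mul, mul_one]
  rw [← ENNReal.ofReal_sum_of_nonneg fun x _ => weight_nonneg hp x, sum_weight_eq_one,
    ENNReal.ofReal_one]

/-- Only the all-ones point of the cube lies above the binary all-ones point, and the latter has
positive mass because all probabilities are positive. -/
theorem one_mem_of_isParetoCover (hp : ∀ i, p i ∈ Set.Ioc (0 : ℝ) 1)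
    (hB : IsParetoCover (bernoulliMeasure p) B) : 1 ∈ B := by
  by_contra h1
  have hp' : ∀ i, p i ∈ Set.Icc (0 : ℝ) 1 := fun i => Set.Ioc_subset_Icc_self (hp i)
  have hx : ¬ ∃ b ∈ B, binaryPoint (fun _ : Fin n => true) ≤ b := by
    rintro ⟨b, hb, h⟩
    have : b = 1 := funext fun i =>
      le_antisymm unitInterval.le_one' (by simpa [binaryPoint] using h i)
    exact h1 (this ▸ hb)
  have h : bernoulliMeasure p {x | ∃ b ∈ B, x ≤ b} ≤
      ENNReal.ofReal (1 - weight p fun _ => true) := by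
    rw [bernoulliMeasure_eq]
    simp only [Measure.coe_finsetSum, Finset.sum_apply, Measure.smul_apply, smul_eq_mul]
    rw [← sum_weight_eq_one p, ← Finset.sum_erase_eq_sub (Finset.mem_univ _),
      ENNReal.ofReal_sum_of_nonneg fun x _ => weight_nonneg hp' x,
      ← Finset.add_sum_erase _ _ (Finset.mem_univ fun _ => true)]
    rw [Measure.dirac_apply, Set.indicator_of_notMem (by simpa using hx), mul_zero, zero_add]
    refine Finset.sum_le_sum fun x _ => ?_
    exact mul_le_of_le_one_right' prob_le_one
  rw [hB] at h
  have hpos : 0 < weight p fun _ => true := by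
    unfold weight
    exact Finset.prod_pos fun i _ => by simpa using (hp i).1
  rw [← ENNReal.ofReal_one, ENNReal.ofReal_le_ofReal_iff'] at h
  rcases h with h | h <;> linarith

/-- The cost of the coordinates of `b` that are equal to `1`. -/
noncomputable def floorCost (c : Fin n → ℝ) (b : Cube n) : ℝ := ∑ i with b i = 1, c i

theorem floorCost_le (hc : ∀ i, 0 ≤ c i) (b : Cube n) :
    floorCost c b ≤ ∑ i, c i * (b i : ℝ) := by
  rw [floorCost, Finset.sum_filter]
  refine Finset.sum_le_sum fun i _ => ?_
  split_ifs with h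
  · simp [h]
  · exact mul_nonneg (hc i) (b i).2.1

theorem le_floorCost (hc : ∀ i, 0 ≤ c i) (b : Cube n) (T : Finset (Fin n))
    (hT : ∀ i ∈ T, b i = 1) : ∑ i ∈ T, c i ≤ floorCost c b :=
  Finset.sum_le_sum_of_subset_of_nonneg (fun i hi => by simpa using hT i hi) fun i _ _ => hc i

/-- Lets lower bounds work with the cover rounded down without replacing its points, so the
cardinality of `B` is not affected when two points round to the same vector. -/
theorem le_coverCost (hc : ∀ i, 0 ≤ c i) {x : Cube n} {r : ℝ}
    (h : ∀ b ∈ B, x ≤ b → r ≤ floorCost c b) : ENNReal.ofReal r ≤ coverCost c B x :=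
  le_iInf₂ fun b hb => le_iInf fun hx =>
    ENNReal.ofReal_le_ofReal ((h b hb hx).trans (floorCost_le hc b))

theorem coverCost_le (c : Fin n → ℝ) {x b : Cube n} (hb : b ∈ B) (hx : x ≤ b) :
    coverCost c B x ≤ ENNReal.ofReal (∑ i, c i * (b i : ℝ)) :=
  iInf₂_le_of_le b hb (iInf_le _ hx)

/-- A bound for the expected cost in terms of a pointwise bound. -/
theorem expectedCost_le (hp : ∀ i, p i ∈ Set.Icc (0 : ℝ) 1) {g : (Fin n → Bool) → ℝ}
    (hg : ∀ x, 0 ≤ g x) (h : ∀ x, coverCost c B (binaryPoint x) ≤ ENNReal.ofReal (g x)) :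
    expectedCost (bernoulliMeasure p) c B ≤ ENNReal.ofReal (∑ x, weight p x * g x) := by
  rw [expectedCost_eq, ENNReal.ofReal_sum_of_nonneg fun x _ =>
    mul_nonneg (weight_nonneg hp x) (hg x)]
  refine Finset.sum_le_sum fun x _ => ?_
  rw [ENNReal.ofReal_mul (weight_nonneg hp x)]
  exact mul_le_mul_right (h x) _

/-- A bound for the expected cost in terms of bounds for the cost at some points. -/
theorem le_expectedCost {ι : Type*} [Fintype ι]
    {x : ι → Fin n → Bool} (hx : Function.Injective x) {r w : ι → ℝ} (hr : ∀ i, 0 ≤ r i)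
    (hw : ∀ i, 0 ≤ w i) (hwx : ∀ i, w i ≤ weight p (x i))
    (h : ∀ i, ENNReal.ofReal (r i) ≤ coverCost c B (binaryPoint (x i))) :
    ENNReal.ofReal (∑ i, w i * r i) ≤ expectedCost (bernoulliMeasure p) c B := by
  classical
  rw [expectedCost_eq, ENNReal.ofReal_sum_of_nonneg fun i _ => mul_nonneg (hw i) (hr i)]
  calc ∑ i, ENNReal.ofReal (w i * r i)
      ≤ ∑ i, ENNReal.ofReal (weight p (x i)) * coverCost c B (binaryPoint (x i)) := by
        refine Finset.sum_le_sum fun i _ => ?_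
        rw [ENNReal.ofReal_mul (hw i)]
        exact mul_le_mul' (ENNReal.ofReal_le_ofReal (hwx i)) (h i)
    _ = ∑ y ∈ Finset.univ.image x, ENNReal.ofReal (weight p y) * coverCost c B (binaryPoint y) := by
        rw [Finset.sum_image fun i _ j _ hij => hx hij]
    _ ≤ _ := Finset.sum_le_sum_of_subset (Finset.subset_univ _)

/-- The union bound for independent events, proved by induction. It bounds all relevant masses from
below by the same factor 1 - Σp. -/
theorem one_sub_sum_le_prod {s : Finset (Fin n)} (hp : ∀ i, p i ∈ Set.Icc (0 : ℝ) 1) :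
    1 - ∑ i, p i ≤ ∏ i ∈ s, (1 - p i) := by
  refine le_trans (b := 1 - ∑ i ∈ s, p i) (sub_le_sub_left
    (Finset.sum_le_sum_of_subset_of_nonneg (Finset.subset_univ s) fun i _ _ => (hp i).1) 1) ?_
  induction s using Finset.induction_on with
  | empty => simp
  | insert i s hi ih =>
    rw [Finset.sum_insert hi, Finset.prod_insert hi]
    have h : 0 ≤ ∑ j ∈ s, p j := Finset.sum_nonneg fun j _ => (hp j).1
    nlinarith [(hp i).1, (hp i).2, mul_le_mul_of_nonneg_left ih (sub_nonneg.2 (hp i).2)]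

theorem le_weight_false (hp : ∀ i, p i ∈ Set.Icc (0 : ℝ) 1) :
    1 - ∑ i, p i ≤ weight p fun _ => false := by
  simpa [weight] using one_sub_sum_le_prod hp (s := Finset.univ)

theorem le_weight_single (hp : ∀ i, p i ∈ Set.Icc (0 : ℝ) 1) (i : Fin n) :
    p i * (1 - ∑ i, p i) ≤ weight p fun j => decide (j = i) := by
  rw [weight, ← Finset.mul_prod_erase _ _ (Finset.mem_univ i)]
  simp only [decide_true, if_true]
  refine mul_le_mul_of_nonneg_left ?_ (hp i).1
  refine (one_sub_sum_le_prod hp (s := Finset.univ.erase i)).trans_eq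
    (Finset.prod_congr rfl fun j hj => ?_)
  simp [Finset.ne_of_mem_erase hj]

end Bernoulli

end ParetoCover

namespace ParetoCover

namespace NumberPartitioningInstance

variable (I : NumberPartitioningInstance)

/-! ### Correctness of the reduction -/

/-- The probabilities in the instance `I.toPareto`. -/
noncomputable def prob : Fin (I.m + 1) → ℝ :=
  Fin.snoc (α := fun _ => ℝ) (fun i => (I.a i : ℝ) / (I.big : ℝ) ^ 4) (1 / (I.big : ℝ) ^ 6)

/-- The costs in the instance `I.toPareto`. -/
noncomputable def cost : Fin (I.m + 1) → ℝ :=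
  Fin.snoc (α := fun _ => ℝ) (fun i => (I.a i : ℝ)) (2 * (I.big : ℝ))

/-- The bound for the expected cost in the instance `I.toPareto`. -/
noncomputable def bound : ℝ :=
  1 / (I.big : ℝ) ^ 4 * ((I.sum : ℝ) ^ 2 / (I.t : ℝ)) + 6 / (I.big : ℝ) ^ 5

@[simp] theorem prob_castSucc (i : Fin I.m) :
    I.prob i.castSucc = (I.a i : ℝ) / (I.big : ℝ) ^ 4 := by simp [prob]

@[simp] theorem prob_last : I.prob (Fin.last I.m) = 1 / (I.big : ℝ) ^ 6 := by simp [prob]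

@[simp] theorem cost_castSucc (i : Fin I.m) : I.cost i.castSucc = (I.a i : ℝ) := by simp [cost]

@[simp] theorem cost_last : I.cost (Fin.last I.m) = 2 * (I.big : ℝ) := by simp [cost]

theorem toPareto_p_castSucc (i : Fin I.m) :
    (I.toPareto.p (i.castSucc : Fin (I.m + 1))).val = (I.a i : ℚ) / (I.big : ℚ) ^ 4 := by
  simp [toPareto, Fraction.val]

theorem toPareto_p_last :
    (I.toPareto.p (Fin.last I.m : Fin (I.m + 1))).val = 1 / (I.big : ℚ) ^ 6 := by
  simp [toPareto, Fraction.val]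

theorem toPareto_c_castSucc (i : Fin I.m) :
    (I.toPareto.c (i.castSucc : Fin (I.m + 1))).val = (I.a i : ℚ) := by
  simp [toPareto, Fraction.val]

theorem toPareto_c_last :
    (I.toPareto.c (Fin.last I.m : Fin (I.m + 1))).val = 2 * (I.big : ℚ) := by
  simp [toPareto, Fraction.val]

theorem toPareto_gamma : I.toPareto.γ.val =
    1 / (I.big : ℚ) ^ 4 * ((I.sum : ℚ) ^ 2 / (I.t : ℚ)) + 6 / (I.big : ℚ) ^ 5 := by
  have h1 : (I.big : ℚ) ≠ 0 := by exact_mod_cast I.big_pos.ne'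
  have h2 : (I.t : ℚ) ≠ 0 := by exact_mod_cast I.t_pos.ne'
  simp only [toPareto, Fraction.val]
  push_cast
  field_simp

theorem big_eq : (I.big : ℝ) = 13 * (I.sum : ℝ) ^ 2 := by simp [big]

theorem one_le_sum : (1 : ℝ) ≤ I.sum := by exact_mod_cast I.sum_pos

theorem thirteen_le_big : (13 : ℝ) ≤ I.big := by
  rw [big_eq]
  nlinarith [I.one_le_sum]

theorem one_le_t : (1 : ℝ) ≤ I.t := by exact_mod_cast I.t_pos

theorem one_le_a (i : Fin I.m) : (1 : ℝ) ≤ I.a i := by exact_mod_cast I.a_pos i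

theorem sum_a : ∑ i, (I.a i : ℝ) = I.sum := by simp [sum]

theorem bound_nonneg : 0 ≤ I.bound := by unfold bound; positivity

theorem isYes_toPareto_iff : I.toPareto.IsYes ↔ ∃ B : Finset (Cube (I.m + 1)),
    IsParetoCover (bernoulliMeasure I.prob) B ∧ B.card = I.t + 2 ∧
    expectedCost (bernoulliMeasure I.prob) I.cost B ≤ ENNReal.ofReal I.bound := by
  have hp : (fun i : Fin (I.m + 1) => ((I.toPareto.p i).val : ℝ)) = I.prob := by
    funext i
    refine Fin.lastCases ?_ (fun i => ?_) i
    · rw [toPareto_p_last]; simp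
    · rw [toPareto_p_castSucc]; simp
  have hc : (fun i : Fin (I.m + 1) => ((I.toPareto.c i).val : ℝ)) = I.cost := by
    funext i
    refine Fin.lastCases ?_ (fun i => ?_) i
    · rw [toPareto_c_last]; simp
    · rw [toPareto_c_castSucc]; simp
  have hg : ((I.toPareto.γ.val : ℚ) : ℝ) = I.bound := by
    rw [toPareto_gamma]; simp [bound]
  -- Since the bound is nonnegative, nothing is lost by truncating it to `ℝ≥0∞`.
  have hE : ∀ E : ℝ≥0∞, (E : EReal) ≤ ((I.bound : ℝ) : EReal) ↔ E ≤ ENNReal.ofReal I.bound := by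
    intro E
    rw [← EReal.coe_ennreal_le_coe_ennreal_iff, EReal.coe_ennreal_ofReal,
      max_eq_left I.bound_nonneg]
  refine exists_congr fun B => ?_
  rw [hg, hE]
  exact Iff.of_eq (congrArg₂ (fun (q d : Fin (I.m + 1) → ℝ) => IsParetoCover (bernoulliMeasure q) B ∧
    B.card = I.t + 2 ∧ expectedCost (bernoulliMeasure q) d B ≤ ENNReal.ofReal I.bound) hp hc)

theorem prob_mem (i : Fin (I.m + 1)) : I.prob i ∈ Set.Ioc (0 : ℝ) 1 := by
  have hM := I.thirteen_le_big
  have hM1 : (1 : ℝ) ≤ I.big := by linarith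
  refine Fin.lastCases ?_ (fun i => ?_) i
  · rw [prob_last]
    exact ⟨by positivity, div_le_one_of_le₀ (one_le_pow₀ hM1) (by positivity)⟩
  · rw [prob_castSucc]
    have h1 : (I.a i : ℝ) ≤ I.big := by exact_mod_cast (I.le_sum i).trans I.sum_le_big
    have := I.one_le_a i
    exact ⟨by positivity, div_le_one_of_le₀ (h1.trans (le_self_pow₀ hM1 (by norm_num)))
      (by positivity)⟩

theorem prob_mem' (i : Fin (I.m + 1)) : I.prob i ∈ Set.Icc (0 : ℝ) 1 :=
  Set.Ioc_subset_Icc_self (I.prob_mem i)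

theorem one_le_cost (i : Fin (I.m + 1)) : 1 ≤ I.cost i := by
  refine Fin.lastCases ?_ (fun i => ?_) i
  · rw [cost_last]; linarith [I.thirteen_le_big]
  · rw [cost_castSucc]; exact I.one_le_a i

theorem cost_nonneg (i : Fin (I.m + 1)) : 0 ≤ I.cost i := zero_le_one.trans (I.one_le_cost i)

theorem sum_prob : ∑ i, I.prob i = I.sum / (I.big : ℝ) ^ 4 + 1 / (I.big : ℝ) ^ 6 := by
  simp [Fin.sum_univ_castSucc, ← Finset.sum_div, sum_a]

theorem sum_cost : ∑ i, I.cost i = I.sum + 2 * I.big := by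
  simp [Fin.sum_univ_castSucc, sum_a]

/-! ### From a partition to a cheap cover -/

/-- The vector of a set of indices, whose last coordinate is `0`. -/
noncomputable def blockPoint (T : Finset (Fin I.m)) : Cube (I.m + 1) :=
  binaryPoint (Fin.snoc (α := fun _ => Bool) (fun i => decide (i ∈ T)) false)

@[simp] theorem blockPoint_castSucc (T : Finset (Fin I.m)) (i : Fin I.m) :
    I.blockPoint T i.castSucc = if i ∈ T then 1 else 0 := by
  simp [blockPoint, binaryPoint]

@[simp] theorem blockPoint_last (T : Finset (Fin I.m)) : I.blockPoint T (Fin.last I.m) = 0 := by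
  simp [blockPoint, binaryPoint]

theorem cost_blockPoint (T : Finset (Fin I.m)) :
    ∑ i, I.cost i * (I.blockPoint T i : ℝ) = ∑ i ∈ T, (I.a i : ℝ) := by
  simp [Fin.sum_univ_castSucc, apply_ite]

theorem blockPoint_injective : Function.Injective I.blockPoint := by
  intro T U h
  ext i
  have := congrFun h i.castSucc
  simp only [blockPoint_castSucc] at this
  by_cases h1 : i ∈ T <;> by_cases h2 : i ∈ U <;> simp_all

/-- Whether all coordinates of `x` in `T` are `1`, as a number. -/
noncomputable def allOnes {n : ℕ} (T : Finset (Fin n)) (x : Fin n → Bool) : ℝ :=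
  if ∀ i ∈ T, x i = true then 1 else 0

theorem allOnes_nonneg {n : ℕ} (T : Finset (Fin n)) (x : Fin n → Bool) : 0 ≤ allOnes T x := by
  unfold allOnes; split_ifs <;> norm_num

/-- A bound for the cost of a point if there are two points of cost `C` and `D` for the unit vectors
and for all points. -/
noncomputable def costBound {m : ℕ} (C D : ℝ) (x : Fin (m + 1) → Bool) : ℝ :=
  ∑ i : Fin m, C * allOnes {i.castSucc} x + D * (allOnes {Fin.last m} x +
    ∑ i : Fin m, ∑ j ∈ Finset.univ.erase i, allOnes {i.castSucc, j.castSucc} x)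

theorem costBound_nonneg {m : ℕ} {C D : ℝ} (hC : 0 ≤ C) (hD : 0 ≤ D) (x : Fin (m + 1) → Bool) :
    0 ≤ costBound C D x :=
  add_nonneg (Finset.sum_nonneg fun _ _ => mul_nonneg hC (allOnes_nonneg _ _))
    (mul_nonneg hD (add_nonneg (allOnes_nonneg _ _)
      (Finset.sum_nonneg fun _ _ => Finset.sum_nonneg fun _ _ => allOnes_nonneg _ _)))

/-- By linearity, as `sum_weight` gives the expectation of every `allOnes T`. Points with several
ones are counted repeatedly in `costBound`, which is harmless for an upper bound. -/
theorem sum_weight_mul_costBound {m : ℕ} (p : Fin (m + 1) → ℝ) (C D : ℝ) :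
    ∑ x, weight p x * costBound C D x = C * ∑ i : Fin m, p i.castSucc + D * (p (Fin.last m) +
      ∑ i : Fin m, ∑ j ∈ Finset.univ.erase i, p i.castSucc * p j.castSucc) := by
  have h : ∀ T : Finset (Fin (m + 1)), ∑ x, weight p x * allOnes T x = ∏ i ∈ T, p i :=
    sum_weight p
  simp only [costBound, mul_add, Finset.sum_add_distrib, Finset.mul_sum]
  congr 1
  · rw [Finset.sum_comm]
    refine Finset.sum_congr rfl fun i _ => ?_
    simp_rw [mul_left_comm _ C]
    rw [← Finset.mul_sum, h, Finset.prod_singleton]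
  · congr 1
    · simp_rw [mul_left_comm _ D]
      rw [← Finset.mul_sum, h, Finset.prod_singleton]
    · rw [Finset.sum_comm]
      refine Finset.sum_congr rfl fun i _ => ?_
      rw [Finset.sum_comm]
      refine Finset.sum_congr rfl fun j hj => ?_
      simp_rw [mul_left_comm _ D]
      rw [← Finset.mul_sum, h, Finset.prod_pair]
      exact fun h => Finset.ne_of_mem_erase hj (Fin.castSucc_injective m h).symm

/-- A point with at least two ones among the first coordinates, or with last coordinate one, or
with at most one one. -/
theorem le_costBound {m : ℕ} {C D : ℝ} (hC : 0 ≤ C) (hD : 0 ≤ D) (x : Fin (m + 1) → Bool) :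
    (x = fun _ => false) ∨ (∃ i : Fin m, (x = fun j => decide (j = i.castSucc)) ∧
      C ≤ costBound C D x) ∨ D ≤ costBound C D x := by
  have hs : ∀ i : Fin (m + 1), x i = true → allOnes {i} x = 1 := fun i hi => by
    simp [allOnes, hi]
  have h1 : 0 ≤ ∑ i : Fin m, C * allOnes {i.castSucc} x :=
    Finset.sum_nonneg fun _ _ => mul_nonneg hC (allOnes_nonneg _ _)
  have h2 : 0 ≤ ∑ i : Fin m, ∑ j ∈ Finset.univ.erase i, allOnes {i.castSucc, j.castSucc} x :=
    Finset.sum_nonneg fun _ _ => Finset.sum_nonneg fun _ _ => allOnes_nonneg _ _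
  have h3 := allOnes_nonneg {Fin.last m} x
  by_cases hl : x (Fin.last m) = true
  · right; right
    rw [costBound, hs _ hl]
    nlinarith
  by_cases h0 : ∃ i : Fin m, x i.castSucc = true
  · obtain ⟨i, hi⟩ := h0
    by_cases hj : ∃ j : Fin m, j ≠ i ∧ x j.castSucc = true
    · obtain ⟨j, hji, hj⟩ := hj
      right; right
      have h4 : 1 ≤ ∑ i : Fin m, ∑ j ∈ Finset.univ.erase i,
          allOnes {i.castSucc, j.castSucc} x := by
        refine le_trans ?_ (Finset.single_le_sum (fun _ _ =>
          Finset.sum_nonneg fun _ _ => allOnes_nonneg _ _) (Finset.mem_univ i))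
        refine le_trans ?_ (Finset.single_le_sum (fun _ _ => allOnes_nonneg _ _)
          (Finset.mem_erase.2 ⟨hji, Finset.mem_univ j⟩))
        simp [allOnes, hi, hj]
      rw [costBound]
      nlinarith
    · push Not at hj
      right; left
      refine ⟨i, funext fun k => ?_, ?_⟩
      · refine Fin.lastCases ?_ (fun k => ?_) k
        · simpa [(Fin.castSucc_lt_last i).ne'] using hl
        · by_cases hk : k = i
          · simp [hk, hi]
          · simpa [hk] using hj k hk
      · rw [costBound]
        have h5 : C ≤ ∑ i : Fin m, C * allOnes {i.castSucc} x := by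
          refine le_trans ?_ (Finset.single_le_sum (fun _ _ => mul_nonneg hC (allOnes_nonneg _ _))
            (Finset.mem_univ i))
          rw [hs _ hi, mul_one]
        nlinarith
  · push Not at h0
    left
    funext k
    refine Fin.lastCases ?_ (fun k => ?_) k
    · simpa using hl
    · simpa using h0 k

/-- A cover for a partition. -/
theorem isYes_toPareto (h : I.IsYes) : I.toPareto.IsYes := by
  obtain ⟨P, hdisj, hcov, hsum⟩ := h
  have hS := I.one_le_sum
  have hM := I.thirteen_le_big
  have ht := I.one_le_t
  have hsum' : ∀ j, ∑ i ∈ P j, (I.a i : ℝ) = I.sum / I.t := by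
    intro j
    have := congrArg (fun q : ℚ => (q : ℝ)) (hsum j)
    push_cast at this
    rw [this, sum_a]
    ring
  -- As S/t > 0, the blocks are nonempty. So they are distinct from each other and from ∅, and the
  -- cover has exactly t + 2 points.
  have hne : ∀ j, (P j).Nonempty := by
    intro j
    by_contra h
    rw [Finset.not_nonempty_iff_eq_empty] at h
    have := hsum' j
    rw [h, Finset.sum_empty] at this
    have : (0 : ℝ) < I.sum / I.t := by positivity
    linarith
  have hP : Function.Injective P := by
    intro j l h
    by_contra hjl
    have : Disjoint (P j) (P l) := hdisj hjl
    rw [h, disjoint_self] at this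
    exact (hne l).ne_empty this
  classical
  let B : Finset (Cube (I.m + 1)) :=
    insert 1 ((insert ∅ (Finset.univ.image P)).image I.blockPoint)
  have h1 : (1 : Cube (I.m + 1)) ∈ B := Finset.mem_insert_self _ _
  have hBT : ∀ T, T = ∅ ∨ (∃ j, P j = T) → I.blockPoint T ∈ B := by
    intro T hT
    simp only [B, Finset.mem_insert, Finset.mem_image, Finset.mem_univ, true_and]
    exact Or.inr ⟨T, hT, rfl⟩
  refine (I.isYes_toPareto_iff).2 ⟨B, isParetoCover_of_one_mem I.prob_mem' h1, ?_, ?_⟩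
  · rw [Finset.card_insert_of_notMem, Finset.card_image_of_injective _ I.blockPoint_injective,
      Finset.card_insert_of_notMem, Finset.card_image_of_injective _ hP, Finset.card_fin]
    · simp only [Finset.mem_image, Finset.mem_univ, true_and, not_exists]
      exact fun j hj => (hne j).ne_empty hj
    · simp only [Finset.mem_image, not_exists, not_and]
      intro T _ hT
      have := congrFun hT (Fin.last I.m)
      simp at this
  · have hC : (0 : ℝ) ≤ I.sum / I.t := by positivity
    -- The all-ones point costs S + 2M ≤ 3M and serves every point that is neither the origin nor a
    -- unit vector e_i with i ≤ m.
    have hD : (0 : ℝ) ≤ 3 * I.big := by positivity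
    have hSM : (I.sum : ℝ) ≤ I.big := by exact_mod_cast I.sum_le_big
    refine (expectedCost_le I.prob_mem' (costBound_nonneg hC hD) fun x => ?_).trans
      (ENNReal.ofReal_le_ofReal ?_)
    · rcases le_costBound hC hD x with rfl | ⟨i, rfl, hx⟩ | hx
      · refine (coverCost_le _ (hBT ∅ (Or.inl rfl)) fun k => ?_).trans
          (ENNReal.ofReal_le_ofReal ?_)
        · simp [binaryPoint]
        · rw [cost_blockPoint, Finset.sum_empty]
          exact costBound_nonneg hC hD _
      · obtain ⟨j, hj⟩ := hcov i
        refine (coverCost_le _ (hBT (P j) (Or.inr ⟨j, rfl⟩)) fun k => ?_).trans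
          (ENNReal.ofReal_le_ofReal ?_)
        · by_cases hk : k = i.castSucc
          · subst hk; simp [binaryPoint, hj]
          · simp [binaryPoint, hk]
        · rw [cost_blockPoint, hsum']
          exact hx
      · refine (coverCost_le _ h1 fun k => unitInterval.le_one').trans
          (ENNReal.ofReal_le_ofReal (le_trans ?_ hx))
        simp only [Pi.one_apply, Set.Icc.coe_one, mul_one, sum_cost]
        linarith
    · have hp : ∑ i : Fin I.m, I.prob i.castSucc = I.sum / (I.big : ℝ) ^ 4 := by
        simp [← Finset.sum_div, sum_a]
      have hpp : ∑ i : Fin I.m, ∑ j ∈ Finset.univ.erase i, I.prob i.castSucc * I.prob j.castSucc ≤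
          (I.sum / (I.big : ℝ) ^ 4) ^ 2 := by
        rw [sq, ← hp, Finset.sum_mul_sum]
        refine Finset.sum_le_sum fun i _ => Finset.sum_le_sum_of_subset_of_nonneg
          (Finset.erase_subset _ _) fun j _ _ =>
            mul_nonneg (I.prob_mem' _).1 (I.prob_mem' _).1
      rw [sum_weight_mul_costBound, hp, prob_last]
      -- The 6/M^5 in γ splits evenly: 3/M^5 for pairs of ones among the first coordinates, here by
      -- S ≤ M, and 3/M^5 for the last coordinate.
      have h2 : 3 * (I.big : ℝ) * (I.sum / (I.big : ℝ) ^ 4) ^ 2 ≤ 3 / (I.big : ℝ) ^ 5 := by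
        rw [div_pow, mul_div_assoc', div_le_div_iff₀ (by positivity) (by positivity)]
        have : (I.sum : ℝ) ^ 2 ≤ (I.big : ℝ) ^ 2 := by gcongr
        have h5 : (0 : ℝ) < 3 * (I.big : ℝ) ^ 6 := by positivity
        nlinarith [mul_le_mul_of_nonneg_left this h5.le]
      have h3 : 3 * (I.big : ℝ) * (1 / (I.big : ℝ) ^ 6) = 3 / (I.big : ℝ) ^ 5 := by
        field_simp
      have h4 := mul_le_mul_of_nonneg_left hpp hD
      have h5 : (I.sum : ℝ) / I.t * (I.sum / (I.big : ℝ) ^ 4) =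
          1 / (I.big : ℝ) ^ 4 * ((I.sum : ℝ) ^ 2 / (I.t : ℝ)) := by
        field_simp
      have h6 : 6 / (I.big : ℝ) ^ 5 = 3 / (I.big : ℝ) ^ 5 + 3 / (I.big : ℝ) ^ 5 := by ring
      rw [bound, h5, mul_add, h3, h6]
      linarith

end NumberPartitioningInstance

end ParetoCover

/-! ### From a cheap cover to a partition -/

namespace ParetoCover

namespace NumberPartitioningInstance

variable (I : NumberPartitioningInstance)

theorem sum_prob_le : ∑ i, I.prob i ≤ 1 / (I.big : ℝ) ^ 3 := by
  have hM := I.thirteen_le_big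
  have hS := I.one_le_sum
  rw [sum_prob]
  have h1 : (I.sum : ℝ) * 13 ≤ I.big := by rw [big_eq]; nlinarith
  rw [div_add_div _ _ (by positivity) (by positivity), div_le_div_iff₀ (by positivity)
    (by positivity)]
  have h2 : (I.sum : ℝ) * (I.big : ℝ) ^ 2 + 1 ≤ (I.big : ℝ) ^ 3 := by nlinarith
  have h3 : (0 : ℝ) < (I.big : ℝ) ^ 7 := by positivity
  nlinarith [mul_le_mul_of_nonneg_left h2 h3.le]

theorem half_le_one_sub : 1 / 2 ≤ 1 - ∑ i, I.prob i := by
  have hM := I.thirteen_le_big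
  have h : 1 / (I.big : ℝ) ^ 3 ≤ 1 / 2 := by
    apply one_div_le_one_div_of_le two_pos
    nlinarith [pow_le_pow_left₀ (by norm_num) hM 3]
  linarith [I.sum_prob_le]

theorem quotient_le : (I.sum : ℝ) ^ 2 / I.t ≤ I.big / 13 := by
  rw [big_eq]
  have := div_le_self (sq_nonneg (I.sum : ℝ)) I.one_le_t
  linarith

/-- By S^2/t ≤ M/13, the bound is at most (1/13 + 6/M^2)/M^3 with M ≥ 13. The threshold 1/M^3 is
what a unit vector of mass at least 1/(2M^4) would contribute at cost 2M. -/
theorem bound_lt : I.bound < 1 / (I.big : ℝ) ^ 3 := by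
  have hM := I.thirteen_le_big
  have h1 : 1 / (I.big : ℝ) ^ 4 * ((I.sum : ℝ) ^ 2 / I.t) ≤ 1 / (I.big : ℝ) ^ 4 * (I.big / 13) :=
    mul_le_mul_of_nonneg_left I.quotient_le (by positivity)
  have h2 : 1 / (I.big : ℝ) ^ 4 * (I.big / 13) = 1 / (I.big : ℝ) ^ 3 * (1 / 13) := by field_simp
  have h3 : 6 / (I.big : ℝ) ^ 5 = 1 / (I.big : ℝ) ^ 3 * (6 / (I.big : ℝ) ^ 2) := by field_simp
  have h4 : 6 / (I.big : ℝ) ^ 2 ≤ 6 / 169 := by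
    apply div_le_div_of_nonneg_left (by norm_num) (by norm_num)
    nlinarith
  have h5 : 0 < 1 / (I.big : ℝ) ^ 3 := by positivity
  unfold bound
  rw [h3]
  nlinarith

/-- The integrality gap 1 beats both errors, measured in units of 1/M^4: the slack 6/M ≤ 6/13 of the
bound, and the loss (Σp)(S^2/t + 1) ≤ 1/M^2 ≤ 1/169 from the factor 1 - Σp. -/
theorem bound_lt_of_lt {Q : ℝ} (hQ : (I.sum : ℝ) ^ 2 / I.t + 1 ≤ Q) :
    I.bound < 1 / (I.big : ℝ) ^ 4 * ((1 - ∑ i, I.prob i) * Q) := by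
  have hM := I.thirteen_le_big
  have hθ := I.half_le_one_sub
  have hq : 0 ≤ (I.sum : ℝ) ^ 2 / I.t := by positivity
  have hq' := I.quotient_le
  have h1 : I.bound = 1 / (I.big : ℝ) ^ 4 * ((I.sum : ℝ) ^ 2 / I.t + 6 / I.big) := by
    unfold bound; field_simp
  rw [h1]
  refine mul_lt_mul_of_pos_left ?_ (by positivity)
  have h2 : 6 / (I.big : ℝ) ≤ 6 / 13 := div_le_div_of_nonneg_left (by norm_num) (by norm_num) hM
  have h3 : (∑ i, I.prob i) * ((I.sum : ℝ) ^ 2 / I.t + 1) ≤ 1 / 169 := by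
    calc (∑ i, I.prob i) * ((I.sum : ℝ) ^ 2 / I.t + 1)
        ≤ 1 / (I.big : ℝ) ^ 3 * I.big := mul_le_mul I.sum_prob_le (by linarith) (by linarith)
          (by positivity)
      _ = 1 / (I.big : ℝ) ^ 2 := by field_simp
      _ ≤ 1 / 169 := one_div_le_one_div_of_le (by norm_num) (by nlinarith)
  nlinarith [mul_le_mul_of_nonneg_left hQ (by linarith : (0 : ℝ) ≤ 1 - ∑ i, I.prob i)]

section Cover

variable {I} {B : Finset (Cube (I.m + 1))}

/-- Some point of the cover is far from all nonzero points. -/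
theorem exists_small (hE : expectedCost (bernoulliMeasure I.prob) I.cost B ≤
    ENNReal.ofReal I.bound) : ∃ b ∈ B, ∀ i, b i ≠ 1 := by
  by_contra h
  push Not at h
  -- If every point of `B` had a coordinate 1, the origin, of mass at least 1/2, would cost at least
  -- 1.
  have h1 := le_expectedCost (ι := Unit) (p := I.prob) (c := I.cost) (B := B)
    (x := fun _ _ => false) (Function.injective_of_subsingleton _) (r := fun _ => 1)
    (w := fun _ => 1 - ∑ i, I.prob i) (fun _ => zero_le_one)
    (fun _ => by linarith [I.half_le_one_sub]) (fun _ => le_weight_false I.prob_mem')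
    (fun _ => le_coverCost I.cost_nonneg fun b hb _ => by
      obtain ⟨i, hi⟩ := h b hb
      refine (I.one_le_cost i).trans ?_
      simpa using le_floorCost I.cost_nonneg b {i} (by simpa using hi))
  have h2 := (ENNReal.ofReal_le_ofReal_iff I.bound_nonneg).1 (h1.trans hE)
  simp only [Finset.univ_unique, Finset.sum_const, Finset.card_singleton, one_smul, mul_one] at h2
  have h3 : 1 / (I.big : ℝ) ^ 3 ≤ 1 / 2 := by
    apply one_div_le_one_div_of_le two_pos
    nlinarith [pow_le_pow_left₀ (by norm_num) I.thirteen_le_big 3]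
  linarith [I.half_le_one_sub, I.bound_lt]

theorem binaryPoint_single_le {n : ℕ} {i : Fin n} {b : Cube n} :
    binaryPoint (fun j => decide (j = i)) ≤ b ↔ b i = 1 := by
  constructor
  · intro h
    refine le_antisymm unitInterval.le_one' ?_
    simpa [binaryPoint] using h i
  · intro h j
    by_cases hj : j = i
    · subst hj; simp [binaryPoint, h]
    · simp [binaryPoint, hj]

/-- Every unit vector is covered by a point of small cost. -/
theorem exists_floorCost_lt (hE : expectedCost (bernoulliMeasure I.prob) I.cost B ≤
    ENNReal.ofReal I.bound) (i : Fin I.m) :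
    ∃ b ∈ B, b i.castSucc = 1 ∧ floorCost I.cost b < 2 * I.big := by
  by_contra h
  push Not at h
  have hM := I.thirteen_le_big
  have hθ := I.half_le_one_sub
  -- Otherwise this unit vector alone contributes at least 2M/(2M^4) = 1/M^3, more than the bound.
  have h1 := le_expectedCost (ι := Unit) (p := I.prob) (c := I.cost) (B := B)
    (x := fun _ j => decide (j = i.castSucc)) (Function.injective_of_subsingleton _)
    (r := fun _ => 2 * I.big)
    (w := fun _ => I.prob i.castSucc * (1 - ∑ i, I.prob i)) (fun _ => by positivity)
    (fun _ => mul_nonneg (I.prob_mem' _).1 (by linarith))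
    (fun _ => le_weight_single I.prob_mem' _)
    (fun _ => le_coverCost I.cost_nonneg fun b hb hx => h b hb (binaryPoint_single_le.1 hx))
  have h2 := (ENNReal.ofReal_le_ofReal_iff I.bound_nonneg).1 (h1.trans hE)
  simp only [Finset.univ_unique, Finset.sum_const, Finset.card_singleton, one_smul,
    prob_castSucc] at h2
  have h3 : 1 / (I.big : ℝ) ^ 4 ≤ I.a i / (I.big : ℝ) ^ 4 := by
    gcongr
    exact I.one_le_a i
  have h4 : 1 / (I.big : ℝ) ^ 4 * (1 / 2) ≤ I.a i / (I.big : ℝ) ^ 4 * (1 - ∑ i, I.prob i) := by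
    gcongr
  have h5 := mul_le_mul_of_nonneg_right h4 (by positivity : (0 : ℝ) ≤ 2 * I.big)
  have h6 : 1 / (I.big : ℝ) ^ 4 * (1 / 2) * (2 * I.big) = 1 / (I.big : ℝ) ^ 3 := by field_simp
  linarith [I.bound_lt]

/-- A partition for a cover. -/
theorem isYes_of_toPareto (h : I.toPareto.IsYes) : I.IsYes := by
  classical
  obtain ⟨B, hcov, hcard, hE⟩ := I.isYes_toPareto_iff.1 h
  have hM := I.thirteen_le_big
  have hθ := I.half_le_one_sub
  have h1 := one_mem_of_isParetoCover I.prob_mem hcov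
  obtain ⟨b₀, hb₀, hb₀'⟩ := exists_small hE
  -- Every unit vector is assigned to a covering point of least rounded cost; the all-ones point
  -- shows that a covering point exists.
  have hmin : ∀ i : Fin I.m, ∃ b ∈ B, b i.castSucc = 1 ∧
      ∀ b' ∈ B, b' i.castSucc = 1 → floorCost I.cost b ≤ floorCost I.cost b' := by
    intro i
    obtain ⟨b, hb, hb'⟩ := Finset.exists_min_image (B.filter fun b => b i.castSucc = 1)
      (floorCost I.cost) ⟨1, by simp [h1]⟩
    rw [Finset.mem_filter] at hb
    exact ⟨b, hb.1, hb.2, fun b' h h' => hb' b' (Finset.mem_filter.2 ⟨h, h'⟩)⟩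
  choose β hβ hβ1 hβmin using hmin
  have hβlt : ∀ i, floorCost I.cost (β i) < 2 * I.big := by
    intro i
    obtain ⟨b, hb, hb1, hlt⟩ := exists_floorCost_lt hE i
    exact (hβmin i b hb hb1).trans_lt hlt
  -- The point `b₀` covers no unit vector, and the all-ones point has rounded cost at least 2M
  -- because of its last coordinate.
  have hβC : ∀ i, β i ∈ (B.erase 1).erase b₀ := by
    intro i
    refine Finset.mem_erase.2 ⟨fun h => hb₀' i.castSucc (h ▸ hβ1 i), Finset.mem_erase.2
      ⟨fun h => ?_, hβ i⟩⟩
    have h2 := hβlt i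
    have h3 := le_floorCost I.cost_nonneg (β i) {Fin.last I.m} (by simp [h])
    rw [Finset.sum_singleton, cost_last] at h3
    linarith
  have hCcard : ((B.erase 1).erase b₀).card = I.t := by
    rw [Finset.card_erase_of_mem, Finset.card_erase_of_mem h1, hcard]
    · rfl
    · refine Finset.mem_erase.2 ⟨fun h => hb₀' 0 (by rw [h]; rfl), hb₀⟩
  let e : (B.erase 1).erase b₀ ≃ Fin I.t := Finset.equivFinOfCardEq hCcard
  let φ : Fin I.m → Fin I.t := fun i => e ⟨β i, hβC i⟩
  let s : Fin I.t → ℕ := fun j => ∑ i with φ i = j, I.a i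
  have hs : ∑ j, s j = I.sum := Finset.sum_fiberwise _ φ I.a
  -- All indices with the same label share the same point β i, which therefore has coordinate 1 at
  -- each of them and pays for their whole sum.
  have hφ : ∀ i, (s (φ i) : ℝ) ≤ floorCost I.cost (β i) := by
    intro i
    have := le_floorCost I.cost_nonneg (β i)
      ((Finset.univ.filter fun k => φ k = φ i).map Fin.castSuccEmb) (by
        intro k hk
        obtain ⟨l, hl, rfl⟩ := Finset.mem_map.1 hk
        have : β l = β i := by
          have := e.injective (Finset.mem_filter.1 hl).2
          exact congrArg Subtype.val this
        rw [← this]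
        exact hβ1 l)
    rw [Finset.sum_map] at this
    simpa [s] using this
  have hEs := le_expectedCost (ι := Fin I.m) (p := I.prob) (c := I.cost) (B := B)
    (x := fun i j => decide (j = i.castSucc)) (fun i k h => by
      have := congrFun h i.castSucc
      simpa using this)
    (r := fun i => (s (φ i) : ℝ))
    (w := fun i => I.prob i.castSucc * (1 - ∑ i, I.prob i)) (fun _ => by positivity)
    (fun _ => mul_nonneg (I.prob_mem' _).1 (by linarith))
    (fun _ => le_weight_single I.prob_mem' _)
    (fun i => le_coverCost I.cost_nonneg fun b hb hx => (hφ i).trans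
      (hβmin i b hb (binaryPoint_single_le.1 hx)))
  have hle := (ENNReal.ofReal_le_ofReal_iff I.bound_nonneg).1 (hEs.trans hE)
  -- Grouping by labels, each a_i with label j is multiplied by s_j, and these a_i add up to s_j.
  have hsq : ∑ i, (I.a i : ℝ) * s (φ i) = ∑ j, (s j : ℝ) ^ 2 := by
    rw [← Finset.sum_fiberwise _ φ]
    refine Finset.sum_congr rfl fun j _ => ?_
    rw [sq]
    conv_rhs => rw [show (s j : ℝ) = ∑ i with φ i = j, (I.a i : ℝ) by simp [s]]
    rw [Finset.sum_mul]
    refine Finset.sum_congr rfl fun i hi => ?_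
    rw [(Finset.mem_filter.1 hi).2]
    simp [s]
  have hle' : 1 / (I.big : ℝ) ^ 4 * ((1 - ∑ i, I.prob i) * ∑ j, (s j : ℝ) ^ 2) ≤ I.bound := by
    rw [← hsq, Finset.mul_sum, Finset.mul_sum]
    refine (Finset.sum_congr rfl fun i _ => ?_).trans_le hle
    rw [prob_castSucc]
    ring
  obtain ⟨q, hq⟩ : I.t ∣ I.sum := I.dvd_sum
  have ht : (I.t : ℝ) ≠ 0 := by exact_mod_cast I.t_pos.ne'
  have heq : ∀ j, s j = q := by
    by_contra hne
    push Not at hne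
    obtain ⟨j, hj⟩ := hne
    -- The deviations s_j - q are integers because t divides S, so one nonzero deviation makes the
    -- sum of squares at least 1.
    have h2 : (1 : ℤ) ≤ ∑ j, ((s j : ℤ) - q) ^ 2 := by
      have h3 : (0 : ℤ) < ((s j : ℤ) - q) ^ 2 := by
        have : (s j : ℤ) - q ≠ 0 := by omega
        positivity
      exact (Int.add_one_le_of_lt h3).trans (Finset.single_le_sum
        (f := fun j => ((s j : ℤ) - q) ^ 2) (fun _ _ => sq_nonneg _) (Finset.mem_univ j))
    have h3 : (1 : ℝ) ≤ ∑ j, ((s j : ℝ) - q) ^ 2 := by exact_mod_cast h2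
    have h4 : ∑ j, ((s j : ℝ) - q) ^ 2 = ∑ j, (s j : ℝ) ^ 2 - (I.sum : ℝ) ^ 2 / I.t := by
      have h5 : (∑ j, (s j : ℝ)) = I.t * q := by
        rw [← Nat.cast_sum, hs, hq]; push_cast; ring
      simp_rw [sub_sq, Finset.sum_add_distrib, Finset.sum_sub_distrib, ← Finset.sum_mul,
        ← Finset.mul_sum, h5]
      simp only [Finset.sum_const, Finset.card_univ, Fintype.card_fin, nsmul_eq_mul, hq]
      push_cast
      field_simp
      ring
    exact absurd hle' (not_le.2 (I.bound_lt_of_lt (by linarith)))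
  refine ⟨fun j => Finset.univ.filter fun i => φ i = j, fun j l hjl => ?_, fun i => ⟨φ i, by simp⟩,
    fun j => ?_⟩
  · refine Finset.disjoint_left.2 fun i hi hi' => ?_
    exact hjl ((Finset.mem_filter.1 hi).2.symm.trans (Finset.mem_filter.1 hi').2)
  · have h2 : (∑ i, (I.a i : ℚ)) = I.t * q := by
      have : ((I.sum : ℕ) : ℚ) = I.t * q := by rw [hq]; push_cast; ring
      rw [← this, sum]
      push_cast
      rfl
    have h3 : (∑ i with φ i = j, (I.a i : ℚ)) = q := by
      rw [← heq j]
      simp [s]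
    have ht' : (I.t : ℚ) ≠ 0 := by exact_mod_cast I.t_pos.ne'
    rw [h2, h3]
    field_simp

end Cover

end NumberPartitioningInstance

end ParetoCover

theorem mainTheorem7 :
    ∃ f : ParetoCover.NumberPartitioningInstance → ParetoCover.BinaryParetoInstance,
      ParetoCover.IsPolyTimeReduction
        ParetoCover.numberPartitioning ParetoCover.binaryParetoCover f ∧
      ∀ I : ParetoCover.NumberPartitioningInstance,
        (f I).k = I.t + 2 ∧
        ∃ hn : (f I).n = I.m + 1,
          let S : ℚ := ∑ i, (I.a i : ℚ)
          let M : ℚ := 13 * S ^ 2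
          (∀ i : Fin I.m,
            ((f I).p (Fin.cast hn.symm i.castSucc)).val = (I.a i : ℚ) / M ^ 4 ∧
            ((f I).c (Fin.cast hn.symm i.castSucc)).val = (I.a i : ℚ)) ∧
          ((f I).p (Fin.cast hn.symm (Fin.last I.m))).val = 1 / M ^ 6 ∧
          ((f I).c (Fin.cast hn.symm (Fin.last I.m))).val = 2 * M ∧
          (f I).γ.val = 1 / M ^ 4 * (S ^ 2 / (I.t : ℚ)) + 6 / M ^ 5 := by
  refine ⟨ParetoCover.NumberPartitioningInstance.toPareto, ⟨ParetoCover.toPareto_computable,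
    fun I => ⟨I.isYes_toPareto, ParetoCover.NumberPartitioningInstance.isYes_of_toPareto⟩⟩,
    fun I => ⟨rfl, rfl, ?_⟩⟩
  have hS : (∑ i, (I.a i : ℚ)) = (I.sum : ℚ) := by
    simp [ParetoCover.NumberPartitioningInstance.sum]
  have hM : 13 * (I.sum : ℚ) ^ 2 = (I.big : ℚ) := by
    simp [ParetoCover.NumberPartitioningInstance.big]
  intro S M
  have hM' : M = (I.big : ℚ) := by simp only [M, S, hS, hM]
  have hS' : S = (I.sum : ℚ) := hS
  rw [hM', hS']
  exact ⟨fun i => ⟨I.toPareto_p_castSucc i, I.toPareto_c_castSucc i⟩, I.toPareto_p_last,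
    I.toPareto_c_last, I.toPareto_gamma⟩
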